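/- **Setting.** There is an infinite set of arms $\mathcal A$. The initial mean rewards $\mu_1(a)$, $a\in\mathcal A$, are i.i.d. random variables on $[0,1]$ such that, for constants $\beta>0$ and $0<c\le C_0$, $c\,x^\beta\le \mathbb P(\mu_1(a)>1-x)\le C_0\,x^\beta$ for all $x\in[0,1]$. In round $t=1,2,\dots,T$ the agent pulls an arm $a_t$ and observes $r_t=\mu_t(a_t)+\eta_t$, where, conditionally on the past (the initial means and all noise terms and rotting rates of earlier rounds), the noise $\eta_t$ is $1$-sub-Gaussian, i.e. $\mathbb E[e^{\lambda\eta_t}\mid \text{past}]\le e^{\lambda^2/2}$ for all $\lambda\in\mathbb R$. Immediately after the pull, an adaptive adversary chooses a rotting rate $\rho_t\ge 0$, depending arbitrarily on everything that has happened so far, and the mean rewards become $\mu_{t+1}(a_t)=\mu_t(a_t)-\rho_t$ and $\mu_{t+1}(a)=\mu_t(a)$ for $a\ne a_t$. In the slow rotting case, $\sum_{t=1}^{T-1}\rho_t\le V_T$ almost surely, for a given $V_T\in[0,T]$. The regret is $R(T)=\sum_{t=1}^{T}(1-\mu_t(a_t))$. **Algorithm** (UCB-threshold with adaptive sliding window,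 with threshold parameter $\delta$). For $s\le t$ let $n_{[s,t]}(a)$ be the number of rounds in $[s,t]$ in which $a$ is pulled, $\widehat\mu_{[s,t]}(a)$ the empirical mean of the rewards of these rounds, and $\mathrm{WUCB}(a,s,t,T)=\widehat\mu_{[s,t]}(a)+\sqrt{12\log (T)/n_{[s,t]}(a)}$. In round $1$ the algorithm selects a new arm $a$, pulls it, and sets $t(a)=1$. In each round $t=2,\dots,T$, with $a$ the current arm and $\mathcal T_t(a)=\{s\in\{1,\dots,T\}: t(a)\le s\le t-1,\ s=t-2^{i}\text{ for some integer } i\ge 0\}$: if $\min_{s\in\mathcal T_t(a)}\mathrm{WUCB}(a,s,t-1,T)<1-\delta$, then it withdraws $a$ for good, selects a new arm $a$ (one never selected before), pulls it, and sets $t(a)=t$; otherwise it pulls the current arm $a$ again. The order in which new arms are selected is an arbitrary fixed sequence of distinct arms. **Theorem.** Fix a constant $0<c_1<1$ and let $$\delta_V(\beta)=\begin{cases}c_1\max\{(V_T/T)^{1/(\beta+2)},\,T^{-1/(\beta+1)}\}&\text{if }\beta\ge 1,\\ c_1\max\{(V_T/T)^{1/3},\,T^{-1/2}\}&\text{if }0<\beta<1.\end{cases}$$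 The algorithm with $\delta=\delta_V(\beta)$ satisfies $$\mathbb E[R(T)]=\begin{cases}\tilde O\big(\max\{V_T^{\frac1{\beta+2}}T^{\frac{\beta+1}{\beta+2}},\,T^{\frac{\beta}{\beta+1}}\}\big)&\text{if }\beta\ge 1,\\ \tilde O\big(\max\{V_T^{1/3}T^{2/3},\,\sqrt T\}\big)&\text{if }0<\beta<1.\end{cases}$$ Here $\mathbb E[R(T)]=\tilde O(f)$ means that there are constants $C>0$ and $k\in\mathbb N$, depending only on $\beta$, $c_1$, $c$ and $C_0$, such that $\mathbb E[R(T)]\le C(1+\log T)^k f$ for all $T\ge 1$, all $V_T\in[0,T]$ and all environments as above. -/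

import Mathlib

open MeasureTheory ProbabilityTheory

namespace RottingBandit

/-! ### Deterministic part: the bandit dynamics and the algorithm along one sample path

Rounds are numbered `1, 2, …, T`; index `0` of the sequences below is never used. -/

/-- `n_{[s,t]}(a)`: the number of rounds in `[s,t]` in which arm `a` was pulled. -/
noncomputable def numPulls {A : Type*} (arms : ℕ → A) (s t : ℕ) (a : A) : ℕ := by
  classical exact ((Finset.Icc s t).filter (fun l => arms l = a)).card

/-- The empirical mean of the rewards of arm `a` over the rounds of `[s,t]`. -/
noncomputable def empMean {A : Type*} (arms : ℕ → A) (r : ℕ → ℝ) (s t : ℕ) (a : A) : ℝ := by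
  classical exact (∑ l ∈ Finset.Icc s t, if arms l = a then r l else 0) / (numPulls arms s t a : ℝ)

/-- The window-UCB index `WUCB(a,s,t,T)`. -/
noncomputable def WUCB {A : Type*} (arms : ℕ → A) (r : ℕ → ℝ) (a : A) (s t T : ℕ) : ℝ :=
  empMean arms r s t a + √(12 * Real.log (T : ℝ) / (numPulls arms s t a : ℝ))

/-- The starting times of the windows of doubling length:
`{s ∈ [T] : t₀ ≤ s ≤ t - 1 and s = t - 2^i for some i ≥ 0}`. -/
def windowStarts (T t₀ t : ℕ) : Set ℕ :=
  {s | 1 ≤ s ∧ s ≤ T ∧ t₀ ≤ s ∧ s + 1 ≤ t ∧ ∃ i : ℕ, s + 2 ^ i = t}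

/-- The mean reward `μ_t(a) = μ_1(a) - ∑_{s<t} ρ_s(a)`, where `ρ_s(a) = ρ_s` if arm `a` is pulled
in round `s` and `ρ_s(a) = 0` otherwise. -/
noncomputable def meanReward {A : Type*} (μ₁ : A → ℝ) (ρ : ℕ → ℝ) (arms : ℕ → A) (t : ℕ) (a : A) :
    ℝ := by
  classical exact μ₁ a - ∑ s ∈ Finset.Ico 1 t, if arms s = a then ρ s else 0

/-- The state of the interaction after some number of rounds. -/
structure Trace (A : Type*) where
  /-- the position, in the order of selection, of the current arm -/
  idx : ℕ
  /-- the round `t(a)` in which the current arm was selected -/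
  start : ℕ
  /-- the arms pulled so far (only the entries of past rounds are meaningful) -/
  arms : ℕ → A
  /-- the rewards observed so far (only the entries of past rounds are meaningful) -/
  rewards : ℕ → ℝ

/-- The threshold condition in round `t`: the minimum over the windows of the window-UCB index of
the current arm is below `1 - δ`. -/
def Trace.Withdraw {A : Type*} (h : Trace A) (sel : ℕ → A) (T : ℕ) (δ : ℝ) (t : ℕ) : Prop :=
  ∃ s ∈ windowStarts T h.start t, WUCB h.arms h.rewards (sel h.idx) s (t - 1) T < 1 - δ

/-- Round `t`: pull the `k`-th arm in the order of selection, which was selected in round `t₀`, and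
observe the reward `r_t = μ_t(a_t) + η_t`. -/
noncomputable def Trace.pull {A : Type*} (h : Trace A) (sel : ℕ → A) (μ₁ : A → ℝ) (ρ η : ℕ → ℝ)
    (t k t₀ : ℕ) : Trace A where
  idx := k
  start := t₀
  arms := Function.update h.arms t (sel k)
  rewards := Function.update h.rewards t (meanReward μ₁ ρ h.arms t (sel k) + η t)

/-- UCB-Threshold with adaptive sliding window, run against the initial means `μ₁`, the rotting
rates `ρ` and the noise `η`: the state after `t` rounds. New arms are selected in the order
`sel 0, sel 1, …`. In round `1` there is no window, so that `sel 0` is pulled, with `t(a) = 1`. -/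
noncomputable def run {A : Type*} (sel : ℕ → A) (T : ℕ) (δ : ℝ) (μ₁ : A → ℝ) (ρ η : ℕ → ℝ) :
    ℕ → Trace A
  | 0 => ⟨0, 1, fun _ => sel 0, fun _ => 0⟩
  | t + 1 => by
      classical
      exact
        let h := run sel T δ μ₁ ρ η t
        if h.Withdraw sel T δ (t + 1) then
          h.pull sel μ₁ ρ η (t + 1) (h.idx + 1) (t + 1)
        else
          h.pull sel μ₁ ρ η (t + 1) h.idx h.start

/-- The regret `∑_{t=1}^T (1 - μ_t(a_t))` of the algorithm along one sample path. -/
noncomputable def regret {A : Type*} (sel : ℕ → A) (T : ℕ) (δ : ℝ) (μ₁ : A → ℝ) (ρ η : ℕ → ℝ) : ℝ :=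
  ∑ t ∈ Finset.Icc 1 T,
    (1 - meanReward μ₁ ρ (run sel T δ μ₁ ρ η T).arms t ((run sel T δ μ₁ ρ η T).arms t))

/-- The threshold parameter `δ_V(β)`. -/
noncomputable def deltaV (c₁ β V : ℝ) (T : ℕ) : ℝ :=
  if 1 ≤ β then
    c₁ * max ((V / T) ^ (1 / (β + 2))) (1 / (T : ℝ) ^ (1 / (β + 1)))
  else
    c₁ * max ((V / T) ^ (1 / 3 : ℝ)) (1 / √(T : ℝ))

/-! ### Probabilistic part -/

/-- The slow rotting environment. `ℱ t` is the information available once round `t` is over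
(`ℱ 0`: before the first round). The initial means are i.i.d. on `[0,1]` with
`cL x^β ≤ ℙ(μ₁(a) > 1 - x) ≤ cU x^β` on `[0,1]`; the noise of each round is `1`-sub-Gaussian
conditionally on the past; the adaptive adversary fixes `ρ_t ≥ 0` after the pull of round `t`,
using anything that has happened so far, with `∑_{t=1}^{T-1} ρ_t ≤ V`. -/
structure IsSlowRotting {A Ω : Type*} [mΩ : MeasurableSpace Ω] (P : Measure Ω)
    (ℱ : Filtration ℕ mΩ) (β cL cU : ℝ) (T : ℕ) (V : ℝ)
    (μ₁ : A → Ω → ℝ) (ρ η : ℕ → Ω → ℝ) : Prop where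
  mean_measurable : ∀ a, Measurable[ℱ 0] (μ₁ a)
  mean_indep : iIndepFun μ₁ P
  mean_ident : ∀ a b, IdentDistrib (μ₁ a) (μ₁ b) P P
  mean_mem : ∀ a, ∀ᵐ ω ∂P, μ₁ a ω ∈ Set.Icc (0 : ℝ) 1
  mean_lower : ∀ a, ∀ x ∈ Set.Icc (0 : ℝ) 1, cL * x ^ β ≤ P.real {ω | 1 - x < μ₁ a ω}
  mean_upper : ∀ a, ∀ x ∈ Set.Icc (0 : ℝ) 1, P.real {ω | 1 - x < μ₁ a ω} ≤ cU * x ^ β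
  noise_measurable : ∀ t, 1 ≤ t → Measurable[ℱ t] (η t)
  noise_integrable : ∀ t, 1 ≤ t → ∀ l : ℝ, Integrable (fun ω => Real.exp (l * η t ω)) P
  noise_subGaussian : ∀ t, 1 ≤ t → ∀ l : ℝ,
    P[fun ω => Real.exp (l * η t ω) | ℱ (t - 1)] ≤ᵐ[P] fun _ => Real.exp (l ^ 2 / 2)
  rot_measurable : ∀ t, 1 ≤ t → Measurable[ℱ t] (ρ t)
  rot_nonneg : ∀ t, 1 ≤ t → ∀ᵐ ω ∂P, 0 ≤ ρ t ω
  rot_budget : ∀ᵐ ω ∂P, ∑ t ∈ Finset.Icc 1 (T - 1), ρ t ω ≤ V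

/-- The regret, as a random variable, of the algorithm with threshold parameter `δ_V(β)`. -/
noncomputable def regretV {A Ω : Type*} (sel : ℕ → A) (T : ℕ) (c₁ β V : ℝ)
    (μ₁ : A → Ω → ℝ) (ρ η : ℕ → Ω → ℝ) (ω : Ω) : ℝ :=
  regret sel T (deltaV c₁ β V T) (fun a => μ₁ a ω) (fun t => ρ t ω) (fun t => η t ω)

end RottingBandit
/- On the event that every window sum of the noise lies within its confidence width, the windows of
doubling length bound the regret of `N` pulls of an arm that keeps passing the test by
`N δ + O(√(N log T))`. The suboptimality `Δ` of an arm never drops below its initial value, so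
`N max(Δ, δ)` obeys the same bound; hence an arm costs `O(log T / max(Δ, δ))` beyond `2 δ` per round
and beyond the rotting it suffers.

On the same event an arm is only withdrawn with suboptimality larger than `δ`, so an arm with
initial mean above `1 - δ/2` has then rotted by at least `δ/2`. At most `2V/δ` such arms are
withdrawn, and a block of `Õ(δ^(-β))` consecutive arms contains one with high probability, so that
`Õ((V/δ + 1) δ^(-β))` arms are tried. The expectation of `1 / max(Δ, δ)` is `Õ(δ^(β - max(β, 1)))`,
and the regret is `Õ(δ T + V + (V/δ + 1) δ^(-max(β, 1)))`, which `δ_V(β)` balances. -/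

namespace RottingBandit

/-- The suboptimality `1 - μ_t(a_t)` of the arm pulled in round `t`, when round `s` pulls the
`κ s`-th arm in the order of selection and the `k`-th arm has initial mean `m k`. -/
noncomputable def gap (m ρ : ℕ → ℝ) (κ : ℕ → ℕ) (t : ℕ) : ℝ :=
  1 - m (κ t) + ∑ u ∈ Finset.Ico 1 t, if κ u = κ t then ρ u else 0

/-- The window-UCB index over the rounds of `[s,t]`, when all of them pull the same arm, so that it
depends on the reward sequence `r` alone. -/
noncomputable def windowUCB (T : ℕ) (r : ℕ → ℝ) (s t : ℕ) : ℝ :=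
  (∑ l ∈ Finset.Icc s t, r l) / ((t + 1 - s : ℕ) : ℝ) +
    √(12 * Real.log T / ((t + 1 - s : ℕ) : ℝ))

/-- The threshold test at the end of round `t` withdraws the current arm, which was selected in
round `τ t`. -/
def Withdraws (T : ℕ) (δ : ℝ) (r : ℕ → ℝ) (τ : ℕ → ℕ) (t : ℕ) : Prop :=
  ∃ s ∈ windowStarts T (τ t) (t + 1), windowUCB T r s t < 1 - δ

/-- The algorithm, driven by the reward sequence `r`, pulls in round `t` the `κ t`-th arm in the
order of selection, which it selected in round `τ t`. -/
structure IsRun (T : ℕ) (δ : ℝ) (r : ℕ → ℝ) (κ τ : ℕ → ℕ) : Prop where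
  idx_zero : κ 0 = 0
  start_zero : τ 0 = 1
  step : ∀ t, (Withdraws T δ r τ t ∧ κ (t + 1) = κ t + 1 ∧ τ (t + 1) = t + 1) ∨
    (¬ Withdraws T δ r τ t ∧ κ (t + 1) = κ t ∧ τ (t + 1) = τ t)

/-- All window sums of the noise `η` lie within the confidence width of the algorithm. -/
def NoiseBounded (T : ℕ) (η : ℕ → ℝ) : Prop :=
  ∀ s t, 1 ≤ s → s ≤ t → t ≤ T →
    |∑ l ∈ Finset.Icc s t, η l| ≤ √(12 * Real.log T * ((t + 1 - s : ℕ) : ℝ))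

section Run

variable {A : Type*}

/-- The position, in the order of selection, of the arm pulled in round `t` of a run. -/
noncomputable def runIdx (sel : ℕ → A) (T : ℕ) (δ : ℝ) (μ₁ : A → ℝ) (ρ η : ℕ → ℝ) (t : ℕ) : ℕ :=
  (run sel T δ μ₁ ρ η t).idx

/-- The round in which a run selected the arm it pulls in round `t`. -/
noncomputable def runStart (sel : ℕ → A) (T : ℕ) (δ : ℝ) (μ₁ : A → ℝ) (ρ η : ℕ → ℝ) (t : ℕ) : ℕ :=
  (run sel T δ μ₁ ρ η t).start

/-- The suboptimality of the arm pulled in round `t` of a run. -/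
noncomputable def runGap (sel : ℕ → A) (T : ℕ) (δ : ℝ) (μ₁ : A → ℝ) (ρ η : ℕ → ℝ) : ℕ → ℝ :=
  gap (fun k => μ₁ (sel k)) ρ (runIdx sel T δ μ₁ ρ η)

variable {sel : ℕ → A} {T : ℕ} {δ : ℝ} {μ₁ : A → ℝ} {ρ η : ℕ → ℝ}

lemma run_arms_succ (t : ℕ) :
    (run sel T δ μ₁ ρ η (t + 1)).arms =
      Function.update (run sel T δ μ₁ ρ η t).arms (t + 1)
        (sel (runIdx sel T δ μ₁ ρ η (t + 1))) := by
  simp only [runIdx, run]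
  split_ifs <;> rfl

lemma run_rewards_succ (t : ℕ) :
    (run sel T δ μ₁ ρ η (t + 1)).rewards =
      Function.update (run sel T δ μ₁ ρ η t).rewards (t + 1)
        (meanReward μ₁ ρ (run sel T δ μ₁ ρ η t).arms (t + 1) (sel (runIdx sel T δ μ₁ ρ η (t + 1)))
          + η (t + 1)) := by
  simp only [runIdx, run]
  split_ifs <;> rfl

lemma run_arms {s t : ℕ} (hs : 1 ≤ s) (hst : s ≤ t) :
    (run sel T δ μ₁ ρ η t).arms s = sel (runIdx sel T δ μ₁ ρ η s) := by
  induction t, hst using Nat.le_induction with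
  | base =>
    obtain ⟨s, rfl⟩ := Nat.exists_eq_add_of_le' hs
    rw [run_arms_succ, Function.update_self]
  | succ t hst ih => rw [run_arms_succ, Function.update_of_ne (by omega), ih]

lemma meanReward_run (hsel : Function.Injective sel) {s t : ℕ} (hst : s ≤ t + 1) :
    meanReward μ₁ ρ (run sel T δ μ₁ ρ η t).arms s (sel (runIdx sel T δ μ₁ ρ η s)) =
      1 - runGap sel T δ μ₁ ρ η s := by
  have hsum : (∑ u ∈ Finset.Ico 1 s, @ite ℝ ((run sel T δ μ₁ ρ η t).arms u =
        sel (runIdx sel T δ μ₁ ρ η s)) (Classical.propDecidable _) (ρ u) 0) =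
      ∑ u ∈ Finset.Ico 1 s, if runIdx sel T δ μ₁ ρ η u = runIdx sel T δ μ₁ ρ η s
        then ρ u else 0 := by
    refine Finset.sum_congr rfl fun u hu => ?_
    rw [Finset.mem_Ico] at hu
    simp only [run_arms hu.1 (by omega : u ≤ t), hsel.eq_iff]
  simp only [meanReward, hsum, runGap, gap]
  ring

lemma run_rewards (hsel : Function.Injective sel) {s t : ℕ} (hs : 1 ≤ s) (hst : s ≤ t) :
    (run sel T δ μ₁ ρ η t).rewards s = (1 - runGap sel T δ μ₁ ρ η + η) s := by
  induction t, hst using Nat.le_induction with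
  | base =>
    obtain ⟨s, rfl⟩ := Nat.exists_eq_add_of_le' hs
    rw [run_rewards_succ, Function.update_self, meanReward_run hsel le_rfl]
    rfl
  | succ t hst ih => rw [run_rewards_succ, Function.update_of_ne (by omega), ih]

lemma regret_eq_sum_runGap (hsel : Function.Injective sel) :
    regret sel T δ μ₁ ρ η = ∑ t ∈ Finset.Icc 1 T, runGap sel T δ μ₁ ρ η t := by
  refine Finset.sum_congr rfl fun t ht => ?_
  rw [Finset.mem_Icc] at ht
  rw [run_arms ht.1 ht.2, meanReward_run hsel (by omega), sub_sub_cancel]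

lemma runIdx_eq_of_runStart_le {s t : ℕ} (hs : runStart sel T δ μ₁ ρ η t ≤ s) (hst : s ≤ t) :
    runIdx sel T δ μ₁ ρ η s = runIdx sel T δ μ₁ ρ η t := by
  induction t with
  | zero => rw [Nat.le_zero.1 hst]
  | succ t ih =>
    rcases Nat.of_le_succ hst with hle | rfl
    · by_cases hw : (run sel T δ μ₁ ρ η t).Withdraw sel T δ (t + 1)
      · simp only [runStart, run, hw, if_true, Trace.pull] at hs
        omega
      · simp only [runStart, runIdx, run, hw, if_false, Trace.pull] at hs ih ⊢
        exact ih hs hle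
    · rfl

lemma WUCB_run (hsel : Function.Injective sel) {s t : ℕ} (hs : 1 ≤ s)
    (hτ : runStart sel T δ μ₁ ρ η t ≤ s) :
    WUCB (run sel T δ μ₁ ρ η t).arms (run sel T δ μ₁ ρ η t).rewards
        (sel (runIdx sel T δ μ₁ ρ η t)) s t T =
      windowUCB T (1 - runGap sel T δ μ₁ ρ η + η) s t := by
  have harm : ∀ l ∈ Finset.Icc s t,
      (run sel T δ μ₁ ρ η t).arms l = sel (runIdx sel T δ μ₁ ρ η t) := by
    intro l hl
    rw [Finset.mem_Icc] at hl
    rw [run_arms (hs.trans hl.1) hl.2, runIdx_eq_of_runStart_le (hτ.trans hl.1) hl.2]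
  have hnum : numPulls (run sel T δ μ₁ ρ η t).arms s t (sel (runIdx sel T δ μ₁ ρ η t)) =
      t + 1 - s := by
    classical rw [numPulls, Finset.filter_true_of_mem harm, Nat.card_Icc]
  rw [WUCB, empMean, windowUCB, hnum]
  congr 2
  refine Finset.sum_congr rfl fun l hl => ?_
  rw [if_pos (harm l hl)]
  rw [Finset.mem_Icc] at hl
  exact run_rewards hsel (hs.trans hl.1) hl.2

lemma withdraw_run_iff (hsel : Function.Injective sel) (t : ℕ) :
    (run sel T δ μ₁ ρ η t).Withdraw sel T δ (t + 1) ↔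
      Withdraws T δ (1 - runGap sel T δ μ₁ ρ η + η) (runStart sel T δ μ₁ ρ η) t := by
  refine exists_congr fun s => and_congr_right fun hs => ?_
  rw [Nat.add_sub_cancel]
  exact iff_of_eq (congrArg (· < 1 - δ) (WUCB_run hsel hs.1 hs.2.2.1))

lemma isRun_run (hsel : Function.Injective sel) :
    IsRun T δ (1 - runGap sel T δ μ₁ ρ η + η) (runIdx sel T δ μ₁ ρ η)
      (runStart sel T δ μ₁ ρ η) where
  idx_zero := rfl
  start_zero := rfl
  step t := by
    rw [← withdraw_run_iff hsel]
    by_cases h : (run sel T δ μ₁ ρ η t).Withdraw sel T δ (t + 1) <;>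
      simp [runIdx, runStart, run, h, Trace.pull]

end Run

section IsRun

variable {T : ℕ} {δ : ℝ} {r : ℕ → ℝ} {κ τ : ℕ → ℕ}

lemma not_withdraws_zero : ¬ Withdraws T δ r τ 0 := by
  rintro ⟨s, ⟨hs, -, -, hs', -⟩, -⟩
  omega

lemma IsRun.idx_mono (h : IsRun T δ r κ τ) : Monotone κ :=
  monotone_nat_of_le_succ fun t => by rcases h.step t with ⟨-, h, -⟩ | ⟨-, h, -⟩ <;> omega

lemma IsRun.start_pos (h : IsRun T δ r κ τ) (t : ℕ) : 1 ≤ τ t := by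
  induction t with
  | zero => exact h.start_zero.ge
  | succ t ih => rcases h.step t with ⟨-, -, h⟩ | ⟨-, -, h⟩ <;> omega

lemma IsRun.start_le (h : IsRun T δ r κ τ) {t : ℕ} (ht : 1 ≤ t) : τ t ≤ t := by
  induction t, ht using Nat.le_induction with
  | base =>
    rcases h.step 0 with ⟨-, -, hτ⟩ | ⟨-, -, hτ⟩
    exacts [hτ.le, (hτ.trans h.start_zero).le]
  | succ t _ ih => rcases h.step t with ⟨-, -, h⟩ | ⟨-, -, h⟩ <;> omega

lemma IsRun.idx_and_start_eq (h : IsRun T δ r κ τ) {s t : ℕ} (hs : τ t ≤ s) (hst : s ≤ t) :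
    κ s = κ t ∧ τ s = τ t := by
  induction t with
  | zero => simp [Nat.le_zero.1 hst]
  | succ t ih =>
    rcases Nat.of_le_succ hst with hle | rfl
    · rcases h.step t with ⟨-, -, hτ⟩ | ⟨-, hκ, hτ⟩
      · omega
      · rw [hκ, hτ]
        exact ih (hτ ▸ hs) hle
    · simp

lemma IsRun.start_eq_one_or (h : IsRun T δ r κ τ) (t : ℕ) :
    τ t = 1 ∨ ∃ s, 1 ≤ s ∧ τ t = s + 1 ∧ κ t = κ s + 1 := by
  induction t with
  | zero => exact Or.inl h.start_zero
  | succ t ih =>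
    rcases h.step t with ⟨hw, hκ, hτ⟩ | ⟨-, hκ, hτ⟩
    · rcases Nat.eq_zero_or_pos t with rfl | ht
      · exact absurd hw not_withdraws_zero
      · exact Or.inr ⟨t, ht, hτ, hκ⟩
    · rwa [hκ, hτ]

lemma IsRun.idx_lt_of_lt_start (h : IsRun T δ r κ τ) {u t : ℕ} (hu : 1 ≤ u) (hut : u < τ t) :
    κ u < κ t := by
  rcases h.start_eq_one_or t with hτ | ⟨s, -, hτ, hκ⟩
  · omega
  · have := h.idx_mono (show u ≤ s by omega)
    omega

lemma IsRun.not_withdraws_of_start_le (h : IsRun T δ r κ τ) {t : ℕ} (ht : τ (t + 1) ≤ t) :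
    ¬ Withdraws T δ r τ t ∧ τ (t + 1) = τ t := by
  rcases h.step t with ⟨-, -, hτ⟩ | ⟨hw, -, hτ⟩
  · omega
  · exact ⟨hw, hτ⟩

lemma IsRun.exists_withdraws (h : IsRun T δ r κ τ) {k n : ℕ} (hk : k < κ n) :
    ∃ t < n, κ t = k ∧ Withdraws T δ r τ t := by
  induction n with
  | zero => simp [h.idx_zero] at hk
  | succ n ih =>
    by_cases hkn : k < κ n
    · obtain ⟨t, ht, h'⟩ := ih hkn
      exact ⟨t, by omega, h'⟩
    · rcases h.step n with ⟨hw, hκ, -⟩ | ⟨-, hκ, -⟩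
      · exact ⟨n, by omega, by omega, hw⟩
      · omega

end IsRun

section Gap

variable {T : ℕ} {δ : ℝ} {m ρ r : ℕ → ℝ} {κ τ : ℕ → ℕ}

lemma sum_ite_idx_mono (hρ : ∀ u, 1 ≤ u → 0 ≤ ρ u) (k : ℕ) :
    Monotone fun t => ∑ u ∈ Finset.Ico 1 t, if κ u = k then ρ u else 0 :=
  fun _ _ hst => Finset.sum_le_sum_of_subset_of_nonneg (Finset.Ico_subset_Ico_right hst)
    fun u hu _ => by split_ifs; exacts [hρ u (Finset.mem_Ico.1 hu).1, le_rfl]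

lemma initial_gap_le_gap (hρ : ∀ u, 1 ≤ u → 0 ≤ ρ u) (t : ℕ) : 1 - m (κ t) ≤ gap m ρ κ t :=
  le_add_of_nonneg_right <| by simpa using sum_ite_idx_mono (κ := κ) hρ (κ t) t.zero_le

lemma gap_mono (hρ : ∀ u, 1 ≤ u → 0 ≤ ρ u) {s t : ℕ} (hst : s ≤ t) (hκ : κ s = κ t) :
    gap m ρ κ s ≤ gap m ρ κ t := by
  rw [gap, gap, hκ]
  exact add_le_add_right (sum_ite_idx_mono hρ (κ t) hst) _

lemma gap_le (hρ : ∀ u, 1 ≤ u → 0 ≤ ρ u) (hm : ∀ k, 0 ≤ m k) {t : ℕ} (ht : t ≤ T) :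
    gap m ρ κ t ≤ 1 + ∑ u ∈ Finset.Ico 1 T, ρ u := by
  refine add_le_add (by linarith [hm (κ t)]) ((sum_ite_idx_mono hρ (κ t) ht).trans ?_)
  refine Finset.sum_le_sum fun u hu => ?_
  split_ifs
  exacts [le_rfl, hρ u (Finset.mem_Ico.1 hu).1]

lemma IsRun.gap_eq (h : IsRun T δ r κ τ) (m ρ : ℕ → ℝ) {t : ℕ} (ht : 1 ≤ t) :
    gap m ρ κ t = 1 - m (κ t) + ∑ u ∈ Finset.Ico (τ t) t, ρ u := by
  rw [gap, ← Finset.sum_Ico_consecutive _ (h.start_pos t) (h.start_le ht), Finset.sum_eq_zero,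
    zero_add]
  · congr 1
    refine Finset.sum_congr rfl fun u hu => if_pos ?_
    rw [Finset.mem_Ico] at hu
    exact (h.idx_and_start_eq hu.1 hu.2.le).1
  · intro u hu
    rw [Finset.mem_Ico] at hu
    exact if_neg (h.idx_lt_of_lt_start hu.1 hu.2).ne

end Gap

section Noise

variable {T : ℕ} {δ : ℝ} {Δ η : ℕ → ℝ} {κ τ : ℕ → ℕ}

lemma mul_windowUCB {s t : ℕ} (hst : s ≤ t) :
    ((t + 1 - s : ℕ) : ℝ) * windowUCB T (1 - Δ + η) s t =
      ((t + 1 - s : ℕ) : ℝ) - ∑ l ∈ Finset.Icc s t, Δ l + ∑ l ∈ Finset.Icc s t, η l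
        + √(12 * Real.log T * ((t + 1 - s : ℕ) : ℝ)) := by
  have hsum : ∑ l ∈ Finset.Icc s t, (1 - Δ + η) l = ((t + 1 - s : ℕ) : ℝ) -
      ∑ l ∈ Finset.Icc s t, Δ l + ∑ l ∈ Finset.Icc s t, η l := by
    simp [Finset.sum_add_distrib, Finset.sum_sub_distrib]
  have hn : (0 : ℝ) < ((t + 1 - s : ℕ) : ℝ) := Nat.cast_pos.2 (by omega)
  rw [windowUCB, hsum]
  generalize ((t + 1 - s : ℕ) : ℝ) = n at hn ⊢
  have hwidth : √(12 * Real.log T * n) = n * √(12 * Real.log T / n) := by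
    rw [show 12 * Real.log T * n = n ^ 2 * (12 * Real.log T / n) by field_simp,
      Real.sqrt_mul (sq_nonneg n), Real.sqrt_sq hn.le]
  rw [hwidth]
  field_simp

lemma NoiseBounded.lt_of_withdraws (hη : NoiseBounded T η) {t : ℕ} (ht : t ≤ T)
    (hw : Withdraws T δ (1 - Δ + η) τ t) (hΔ : ∀ l, τ t ≤ l → l ≤ t → Δ l ≤ Δ t) : δ < Δ t := by
  obtain ⟨s, ⟨hs, -, hτs, hst, -⟩, hlt⟩ := hw
  replace hst : s ≤ t := by omega
  have hn : (0 : ℝ) < ((t + 1 - s : ℕ) : ℝ) := Nat.cast_pos.2 (by omega)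
  have hucb := mul_lt_mul_of_pos_left hlt hn
  rw [mul_windowUCB hst] at hucb
  have hnoise := (abs_le.1 (hη s t hs hst ht)).1
  have hsum : ∑ l ∈ Finset.Icc s t, Δ l ≤ ((t + 1 - s : ℕ) : ℝ) * Δ t := by
    rw [← nsmul_eq_mul, ← Nat.card_Icc]
    refine Finset.sum_le_card_nsmul _ _ _ fun l hl => ?_
    rw [Finset.mem_Icc] at hl
    exact hΔ l (hτs.trans hl.1) hl.2
  exact lt_of_mul_lt_mul_left (by linarith) hn.le

lemma NoiseBounded.sum_gap_le_of_not_withdraws (hη : NoiseBounded T η) {s t i : ℕ} (hs : 1 ≤ s)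
    (hτ : τ t ≤ s) (hi : s + 2 ^ i = t + 1) (ht : t ≤ T)
    (hw : ¬ Withdraws T δ (1 - Δ + η) τ t) :
    ∑ l ∈ Finset.Icc s t, Δ l ≤ 2 ^ i * δ + 2 * √(12 * Real.log T * 2 ^ i) := by
  have hi' : 1 ≤ 2 ^ i := Nat.one_le_two_pow
  have hst : s ≤ t := by omega
  have hn : ((t + 1 - s : ℕ) : ℝ) = 2 ^ i := by
    rw [← hi, Nat.add_sub_cancel_left, Nat.cast_pow, Nat.cast_ofNat]
  have hge : 1 - δ ≤ windowUCB T (1 - Δ + η) s t :=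
    not_lt.1 fun hlt => hw ⟨s, ⟨hs, hst.trans ht, hτ, by omega, i, hi⟩, hlt⟩
  have hucb := mul_le_mul_of_nonneg_left hge (by positivity : (0 : ℝ) ≤ 2 ^ i)
  have hnoise := (abs_le.1 (hη s t hs hst ht)).2
  rw [← hn, mul_windowUCB hst, hn] at hucb
  rw [hn] at hnoise
  linarith

lemma two_mul_sqrt_add_five_mul_sqrt_le {a b : ℝ} (hb : 0 ≤ b) (hab : b ≤ a) :
    2 * √a + 5 * √b ≤ 5 * √(a + b) := by
  have ha : 0 ≤ a := hb.trans hab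
  have hmul := mul_le_mul_of_nonneg_left (Real.sqrt_le_sqrt hab) (Real.sqrt_nonneg a)
  refine (pow_le_pow_iff_left₀ (by positivity) (by positivity) two_ne_zero).1 ?_
  nlinarith [Real.sq_sqrt ha, Real.sq_sqrt hb, Real.sq_sqrt (add_nonneg ha hb)]

/- Split off the last `2 ^ i` pulls, `2 ^ i` being the largest power of two up to the number of
pulls: they form a window that passed the test, and at most `2 ^ i` pulls are left. -/
lemma IsRun.sum_gap_le (h : IsRun T δ (1 - Δ + η) κ τ) (hη : NoiseBounded T η) (t : ℕ)
    (ht : t ≤ T) :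
    ∑ l ∈ Finset.Ico (τ t) t, Δ l ≤
      ((t - τ t : ℕ) : ℝ) * δ + 5 * √(12 * Real.log T * ((t - τ t : ℕ) : ℝ)) := by
  induction t using Nat.strong_induction_on with
  | _ t ih =>
    rcases le_or_gt t (τ t) with hle | hlt
    · simp [Finset.Ico_eq_empty_of_le hle, Nat.sub_eq_zero_of_le hle]
    have hτ1 := h.start_pos t
    obtain ⟨t, rfl⟩ := Nat.exists_eq_add_of_le' (show 1 ≤ t by omega)
    set N := t + 1 - τ (t + 1)
    have hle : 2 ^ Nat.log 2 N ≤ N := Nat.pow_log_le_self 2 (by omega)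
    have hlt2 : N < 2 ^ (Nat.log 2 N + 1) := Nat.lt_pow_succ_log_self one_lt_two N
    set i := Nat.log 2 N
    have hi : 1 ≤ 2 ^ i := Nat.one_le_two_pow
    obtain ⟨s, hs⟩ : ∃ s, s + 2 ^ i = t + 1 := ⟨t + 1 - 2 ^ i, by omega⟩
    obtain ⟨hw, hτ⟩ := h.not_withdraws_of_start_le (t := t) (by omega)
    have hτs : τ s = τ (t + 1) := (h.idx_and_start_eq (by omega) (by omega)).2
    have hwindow := hη.sum_gap_le_of_not_withdraws (by omega) (by omega) hs (by omega) hw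
    have hrest := ih s (by omega) (by omega)
    rw [hτs] at hrest
    rw [← Finset.sum_Ico_consecutive _ (by omega : τ (t + 1) ≤ s) (by omega : s ≤ t + 1),
      Finset.Ico_add_one_right_eq_Icc]
    have hsplit : (N : ℝ) = 2 ^ i + ((s - τ (t + 1) : ℕ) : ℝ) := by
      exact_mod_cast (by omega : N = 2 ^ i + (s - τ (t + 1)))
    have hhalf : ((s - τ (t + 1) : ℕ) : ℝ) ≤ 2 ^ i := by
      exact_mod_cast (by omega : s - τ (t + 1) ≤ 2 ^ i)
    have hL : 0 ≤ 12 * Real.log T := mul_nonneg (by norm_num) (Real.log_natCast_nonneg T)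
    have hsqrt := two_mul_sqrt_add_five_mul_sqrt_le (mul_nonneg hL (Nat.cast_nonneg _))
      (mul_le_mul_of_nonneg_left hhalf hL)
    rw [← mul_add, ← hsplit] at hsqrt
    rw [hsplit] at hsqrt ⊢
    linarith

lemma five_mul_sqrt_le {L N δ D : ℝ} (hL : 0 ≤ L) (hN : 0 ≤ N) (hδ : 0 ≤ δ) (hD : 0 < D)
    (h : N * D ≤ N * δ + 5 * √(12 * L * N)) :
    5 * √(12 * L * N) ≤ N * δ + 400 * L * D⁻¹ := by
  have amgm : 5 * √(12 * L * N) ≤ N * D / 4 + 300 * L * D⁻¹ := by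
    refine (pow_le_pow_iff_left₀ (by positivity) (by positivity) two_ne_zero).1 ?_
    have hmul : N * D * (300 * L * D⁻¹) = 300 * L * N := by field_simp
    rw [mul_pow, Real.sq_sqrt (by positivity)]
    nlinarith [sq_nonneg (N * D / 4 - 300 * L * D⁻¹)]
  linarith [mul_nonneg hN hδ]

end Noise

section Regret

variable {T : ℕ} {δ : ℝ} {m ρ η : ℕ → ℝ} {κ τ : ℕ → ℕ}

lemma IsRun.card_mul_max_le (h : IsRun T δ (1 - gap m ρ κ + η) κ τ) (hη : NoiseBounded T η)
    (hρ : ∀ u, 1 ≤ u → 0 ≤ ρ u) {t : ℕ} (ht : t ≤ T) :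
    ((t - τ t : ℕ) : ℝ) * max (1 - m (κ t)) δ ≤
      ((t - τ t : ℕ) : ℝ) * δ + 5 * √(12 * Real.log T * ((t - τ t : ℕ) : ℝ)) := by
  rw [mul_max_of_nonneg _ _ (Nat.cast_nonneg _)]
  refine max_le (le_trans ?_ (h.sum_gap_le hη t ht)) (le_add_of_nonneg_right (by positivity))
  rw [← nsmul_eq_mul, ← Nat.card_Ico]
  refine Finset.card_nsmul_le_sum _ _ _ fun l hl => ?_
  rw [Finset.mem_Ico] at hl
  rw [← (h.idx_and_start_eq hl.1 hl.2.le).1]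
  exact initial_gap_le_gap hρ l

lemma IsRun.sum_gap_current_le (h : IsRun T δ (1 - gap m ρ κ + η) κ τ) (hη : NoiseBounded T η)
    (hρ : ∀ u, 1 ≤ u → 0 ≤ ρ u) (hm : ∀ k, 0 ≤ m k) (hδ : 0 < δ) (hδ1 : δ ≤ 1) {t : ℕ}
    (ht : 1 ≤ t) (htT : t ≤ T) :
    ∑ l ∈ Finset.Ico (τ t) (t + 1), gap m ρ κ l ≤ 2 * δ * ((t - τ t : ℕ) : ℝ) +
      400 * (1 + Real.log T) * (max (1 - m (κ t)) δ)⁻¹ + ∑ u ∈ Finset.Ico (τ t) t, ρ u := by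
  have hD : 0 < max (1 - m (κ t)) δ := lt_max_of_lt_right hδ
  have hD1 : 1 ≤ (max (1 - m (κ t)) δ)⁻¹ :=
    (one_le_inv₀ hD).2 (max_le (by linarith [hm (κ t)]) hδ1)
  have hpast := h.sum_gap_le hη t htT
  have hsqrt := five_mul_sqrt_le (Real.log_natCast_nonneg T) (Nat.cast_nonneg _) hδ.le hD
    (h.card_mul_max_le hη hρ htT)
  have hlast : gap m ρ κ t ≤ 1 + ∑ u ∈ Finset.Ico (τ t) t, ρ u := by
    rw [h.gap_eq m ρ ht]
    linarith [hm (κ t)]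
  rw [Finset.sum_Ico_succ_top (h.start_le ht)]
  linarith

lemma IsRun.sum_gap_total_le (h : IsRun T δ (1 - gap m ρ κ + η) κ τ) (hη : NoiseBounded T η)
    (hρ : ∀ u, 1 ≤ u → 0 ≤ ρ u) (hm : ∀ k, 0 ≤ m k) (hδ : 0 < δ) (hδ1 : δ ≤ 1) {t : ℕ}
    (ht : 1 ≤ t) (htT : t ≤ T) :
    ∑ l ∈ Finset.Ico 1 (t + 1), gap m ρ κ l ≤ 2 * δ * t +
      400 * (1 + Real.log T) * ∑ k ∈ Finset.range (κ t + 1), (max (1 - m k) δ)⁻¹ +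
        ∑ u ∈ Finset.Ico 1 t, ρ u := by
  induction t using Nat.strong_induction_on with
  | _ t ih =>
    have hτ := h.start_le ht
    have hτ1 := h.start_pos t
    have hprev : ∑ l ∈ Finset.Ico 1 (τ t), gap m ρ κ l ≤ 2 * δ * ((τ t - 1 : ℕ) : ℝ) +
        400 * (1 + Real.log T) * ∑ k ∈ Finset.range (κ t), (max (1 - m k) δ)⁻¹ +
          ∑ u ∈ Finset.Ico 1 (τ t), ρ u := by
      rcases h.start_eq_one_or t with hτ | ⟨s, hs, hτ, hκ⟩
      · have hL := Real.log_natCast_nonneg T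
        have hsum : 0 ≤ ∑ k ∈ Finset.range (κ t), (max (1 - m k) δ)⁻¹ :=
          Finset.sum_nonneg fun k _ => inv_nonneg.2 (le_max_of_le_right hδ.le)
        simp only [hτ, Finset.Ico_self, Finset.sum_empty, Nat.sub_self, Nat.cast_zero, mul_zero]
        positivity
      · rw [hτ, hκ, Nat.add_sub_cancel, Finset.sum_Ico_succ_top hs ρ]
        linarith [ih s (by omega) hs (by omega), hρ s hs]
    have hcurrent := h.sum_gap_current_le hη hρ hm hδ hδ1 ht htT
    have hrounds : ((τ t - 1 : ℕ) : ℝ) + ((t - τ t : ℕ) : ℝ) ≤ t := by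
      exact_mod_cast (by omega : τ t - 1 + (t - τ t) ≤ t)
    have hδrounds := mul_le_mul_of_nonneg_left hrounds (by positivity : 0 ≤ 2 * δ)
    rw [← Finset.sum_Ico_consecutive _ hτ1 (by omega : τ t ≤ t + 1),
      ← Finset.sum_Ico_consecutive ρ hτ1 hτ, Finset.sum_range_succ]
    linarith

lemma IsRun.half_le_sum_rot (h : IsRun T δ (1 - gap m ρ κ + η) κ τ) (hη : NoiseBounded T η)
    (hρ : ∀ u, 1 ≤ u → 0 ≤ ρ u) {k : ℕ} (hk : k < κ T) (hgood : 1 - δ / 2 < m k) :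
    δ / 2 ≤ ∑ u ∈ Finset.Ico 1 T, if κ u = k then ρ u else 0 := by
  obtain ⟨t, ht, rfl, hw⟩ := h.exists_withdraws hk
  have hlt := hη.lt_of_withdraws ht.le hw fun l hτl hlt =>
    gap_mono hρ hlt (h.idx_and_start_eq hτl hlt).1
  rw [gap] at hlt
  exact le_trans (by linarith) (sum_ite_idx_mono hρ (κ t) ht.le)

lemma IsRun.card_mul_half_le (h : IsRun T δ (1 - gap m ρ κ + η) κ τ) (hη : NoiseBounded T η)
    (hρ : ∀ u, 1 ≤ u → 0 ≤ ρ u) {S : Finset ℕ} (hS : ∀ k ∈ S, k < κ T ∧ 1 - δ / 2 < m k) :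
    S.card * (δ / 2) ≤ ∑ u ∈ Finset.Ico 1 T, ρ u := by
  calc S.card * (δ / 2)
      = ∑ k ∈ S, δ / 2 := by rw [Finset.sum_const, nsmul_eq_mul]
    _ ≤ ∑ k ∈ S, ∑ u ∈ Finset.Ico 1 T, if κ u = k then ρ u else 0 :=
        Finset.sum_le_sum fun k hk => h.half_le_sum_rot hη hρ (hS k hk).1 (hS k hk).2
    _ = ∑ u ∈ Finset.Ico 1 T, ∑ k ∈ S, if κ u = k then ρ u else 0 := Finset.sum_comm
    _ ≤ ∑ u ∈ Finset.Ico 1 T, ρ u := by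
        refine Finset.sum_le_sum fun u hu => ?_
        rw [Finset.sum_ite_eq]
        split_ifs
        exacts [le_rfl, hρ u (Finset.mem_Ico.1 hu).1]

lemma exists_finset_card_eq_of_blocks {p : ℕ → Prop} {M B : ℕ}
    (hB : ∀ j < M, ∃ k ∈ Finset.Ico (j * B) ((j + 1) * B), p k) :
    ∃ S : Finset ℕ, S.card = M ∧ ∀ k ∈ S, k < M * B ∧ p k := by
  choose! f hf hp using hB
  have hdiv : ∀ j < M, f j / B = j := fun j hj =>
    Nat.div_eq_of_lt_le (Finset.mem_Ico.1 (hf j hj)).1 (Finset.mem_Ico.1 (hf j hj)).2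
  refine ⟨(Finset.range M).image f, ?_, ?_⟩
  · rw [Finset.card_image_of_injOn, Finset.card_range]
    intro i hi j hj hij
    rw [← hdiv i (Finset.mem_range.1 hi), ← hdiv j (Finset.mem_range.1 hj), hij]
  · simp only [Finset.forall_mem_image, Finset.mem_range]
    exact fun j hj => ⟨(Finset.mem_Ico.1 (hf j hj)).2.trans_le (Nat.mul_le_mul_right B hj), hp j hj⟩

lemma IsRun.idx_lt_of_blocks (h : IsRun T δ (1 - gap m ρ κ + η) κ τ) (hη : NoiseBounded T η)
    (hρ : ∀ u, 1 ≤ u → 0 ≤ ρ u) {M B : ℕ} (hM : ∑ u ∈ Finset.Ico 1 T, ρ u < M * (δ / 2))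
    (hB : ∀ j < M, ∃ k ∈ Finset.Ico (j * B) ((j + 1) * B), 1 - δ / 2 < m k) :
    κ T < M * B := by
  by_contra! hκ
  obtain ⟨S, rfl, hS⟩ := exists_finset_card_eq_of_blocks hB
  exact hM.not_ge (h.card_mul_half_le hη hρ fun k hk => ⟨(hS k hk).1.trans_le hκ, (hS k hk).2⟩)

lemma IsRun.sum_gap_le_of_blocks (h : IsRun T δ (1 - gap m ρ κ + η) κ τ) (hη : NoiseBounded T η)
    (hρ : ∀ u, 1 ≤ u → 0 ≤ ρ u) (hm : ∀ k, 0 ≤ m k) (hδ : 0 < δ) (hδ1 : δ ≤ 1) (hT : 1 ≤ T)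
    {M B : ℕ} (hM : ∑ u ∈ Finset.Ico 1 T, ρ u < M * (δ / 2))
    (hB : ∀ j < M, ∃ k ∈ Finset.Ico (j * B) ((j + 1) * B), 1 - δ / 2 < m k) :
    ∑ t ∈ Finset.Icc 1 T, gap m ρ κ t ≤ 2 * δ * T +
      400 * (1 + Real.log T) * ∑ k ∈ Finset.range (M * B), (max (1 - m k) δ)⁻¹ +
        ∑ u ∈ Finset.Ico 1 T, ρ u := by
  have hκ := h.idx_lt_of_blocks hη hρ hM hB
  rw [← Finset.Ico_add_one_right_eq_Icc]
  refine (h.sum_gap_total_le hη hρ hm hδ hδ1 hT le_rfl).trans ?_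
  gcongr
  exact hκ

end Regret

/-- The noise is adapted to `ℱ` from round `1` on and conditionally `1`-sub-Gaussian given the
past. The filtered space need not be standard Borel, so the condition is stated through `condExp`
rather than through `HasCondSubgaussianMGF`. -/
structure IsSubGaussianNoise {Ω : Type*} [mΩ : MeasurableSpace Ω] (P : Measure Ω)
    (ℱ : Filtration ℕ mΩ) (η : ℕ → Ω → ℝ) : Prop where
  measurable : ∀ t, 1 ≤ t → Measurable[ℱ t] (η t)
  integrable_exp_mul : ∀ t, 1 ≤ t → ∀ l : ℝ, Integrable (fun ω => Real.exp (l * η t ω)) P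
  condExp_le : ∀ t, 1 ≤ t → ∀ l : ℝ,
    P[fun ω => Real.exp (l * η t ω) | ℱ (t - 1)] ≤ᵐ[P] fun _ => Real.exp (l ^ 2 / 2)

section Concentration

variable {Ω : Type*} {m mΩ : MeasurableSpace Ω} {P : Measure Ω} {X Y : Ω → ℝ} {cX cY : NNReal}

lemma hasSubgaussianMGF_of_condExp_le [IsProbabilityMeasure P] (hm : m ≤ mΩ)
    (hY : ∀ l : ℝ, Integrable (fun ω => Real.exp (l * Y ω)) P)
    (hYm : ∀ l : ℝ, P[fun ω => Real.exp (l * Y ω) | m] ≤ᵐ[P] fun _ => Real.exp (cY * l ^ 2 / 2)) :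
    HasSubgaussianMGF Y cY P where
  integrable_exp_mul := hY
  mgf_le l := by
    rw [mgf, ← integral_condExp hm]
    simpa using integral_mono_ae integrable_condExp (integrable_const _) (hYm l)

lemma hasSubgaussianMGF_add_of_condExp_le [IsProbabilityMeasure P] (hm : m ≤ mΩ)
    (hX : HasSubgaussianMGF X cX P) (hXm : Measurable[m] X)
    (hY : ∀ l : ℝ, Integrable (fun ω => Real.exp (l * Y ω)) P)
    (hYm : ∀ l : ℝ, P[fun ω => Real.exp (l * Y ω) | m] ≤ᵐ[P] fun _ => Real.exp (cY * l ^ 2 / 2)) :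
    HasSubgaussianMGF (fun ω => X ω + Y ω) (cX + cY) P := by
  have hadd := hX.add (hasSubgaussianMGF_of_condExp_le hm hY hYm)
  refine ⟨hadd.integrable_exp_mul, fun l => ?_⟩
  have hmul : (fun ω => Real.exp (l * (X ω + Y ω))) =
      (fun ω => Real.exp (l * X ω)) * fun ω => Real.exp (l * Y ω) := by
    ext ω
    rw [Pi.mul_apply, ← Real.exp_add, mul_add]
  have hint := hadd.integrable_exp_mul l
  have hexpX : StronglyMeasurable[m] fun ω => Real.exp (l * X ω) :=
    (Real.measurable_exp.comp (hXm.const_mul l)).stronglyMeasurable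
  have hpull := condExp_mul_of_stronglyMeasurable_left hexpX (hmul ▸ hint) (hY l)
  rw [← hmul] at hpull
  calc mgf (fun ω => X ω + Y ω) P l
      = ∫ ω, (P[fun ω => Real.exp (l * (X ω + Y ω)) | m]) ω ∂P := (integral_condExp hm).symm
    _ ≤ ∫ ω, Real.exp (l * X ω) * Real.exp (cY * l ^ 2 / 2) ∂P := by
        refine integral_mono_ae integrable_condExp ((hX.integrable_exp_mul l).mul_const _) ?_
        filter_upwards [hpull, hYm l] with ω hω hYω
        rw [hω]
        exact mul_le_mul_of_nonneg_left hYω (Real.exp_nonneg _)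
    _ = mgf X P l * Real.exp (cY * l ^ 2 / 2) := integral_mul_const _ _
    _ ≤ Real.exp (cX * l ^ 2 / 2) * Real.exp (cY * l ^ 2 / 2) :=
        mul_le_mul_of_nonneg_right (hX.mgf_le l) (Real.exp_nonneg _)
    _ = Real.exp ((cX + cY : NNReal) * l ^ 2 / 2) := by
        rw [← Real.exp_add, NNReal.coe_add]
        ring_nf

lemma measureReal_lt_abs_le_of_hasSubgaussianMGF [IsFiniteMeasure P]
    (hX : HasSubgaussianMGF X cX P) {ε : ℝ} (hε : 0 ≤ ε) :
    P.real {ω | ε < |X ω|} ≤ 2 * Real.exp (-ε ^ 2 / (2 * cX)) := by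
  calc P.real {ω | ε < |X ω|}
      ≤ P.real ({ω | ε ≤ X ω} ∪ {ω | ε ≤ (-X) ω}) :=
        measureReal_mono fun ω hω => (lt_abs.1 hω).imp
          (fun h : ε < X ω => h.le) fun h : ε < -X ω => h.le
    _ ≤ P.real {ω | ε ≤ X ω} + P.real {ω | ε ≤ (-X) ω} := measureReal_union_le _ _
    _ ≤ _ := (add_le_add (hX.measure_ge_le hε) (hX.neg.measure_ge_le hε)).trans_eq
        (two_mul _).symm

variable {ℱ : Filtration ℕ mΩ} {η : ℕ → Ω → ℝ}

lemma IsSubGaussianNoise.hasSubgaussianMGF_sum [IsProbabilityMeasure P]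
    (hη : IsSubGaussianNoise P ℱ η) {s t : ℕ} (hs : 1 ≤ s) (hst : s ≤ t) :
    HasSubgaussianMGF (fun ω => ∑ l ∈ Finset.Ico s t, η l ω) (t - s : ℕ) P := by
  induction t, hst using Nat.le_induction with
  | base => simp
  | succ t hst ih =>
    have hpast : Measurable[ℱ (t - 1)] fun ω => ∑ l ∈ Finset.Ico s t, η l ω := by
      refine Finset.measurable_fun_sum _ fun l hl => ?_
      rw [Finset.mem_Ico] at hl
      exact (hη.measurable l (hs.trans hl.1)).mono (ℱ.mono (by omega)) le_rfl
    simp only [Finset.sum_Ico_succ_top hst, Nat.succ_sub hst, Nat.cast_succ]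
    refine hasSubgaussianMGF_add_of_condExp_le (ℱ.le (t - 1)) ih hpast
      (hη.integrable_exp_mul t (by omega)) fun l => ?_
    simpa using hη.condExp_le t (by omega) l

lemma IsSubGaussianNoise.measureReal_lt_abs_sum_le [IsProbabilityMeasure P]
    (hη : IsSubGaussianNoise P ℱ η) {s t : ℕ} (hs : 1 ≤ s) (hst : s ≤ t) {L : ℝ} (hL : 0 ≤ L) :
    P.real {ω | √(12 * L * ((t + 1 - s : ℕ) : ℝ)) < |∑ l ∈ Finset.Icc s t, η l ω|} ≤
      2 * Real.exp (-6 * L) := by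
  have hn : (0 : ℝ) < ((t + 1 - s : ℕ) : ℝ) := Nat.cast_pos.2 (by omega)
  have htail := measureReal_lt_abs_le_of_hasSubgaussianMGF
    (hη.hasSubgaussianMGF_sum hs (by omega : s ≤ t + 1))
    (Real.sqrt_nonneg (12 * L * ((t + 1 - s : ℕ) : ℝ)))
  rw [Real.sq_sqrt (by positivity), NNReal.coe_natCast,
    show -(12 * L * ((t + 1 - s : ℕ) : ℝ)) / (2 * ((t + 1 - s : ℕ) : ℝ)) = -6 * L by
      field_simp; ring] at htail
  rwa [← Finset.Ico_add_one_right_eq_Icc]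

lemma IsSubGaussianNoise.measureReal_not_noiseBounded_le [IsProbabilityMeasure P]
    (hη : IsSubGaussianNoise P ℱ η) (T : ℕ) :
    P.real {ω | ¬ NoiseBounded T (η · ω)} ≤ (T : ℝ) ^ 2 * (2 * Real.exp (-6 * Real.log T)) := by
  let windows := (Finset.Icc 1 T ×ˢ Finset.Icc 1 T).filter fun w => w.1 ≤ w.2
  let excess (w : ℕ × ℕ) : Set Ω :=
    {ω | √(12 * Real.log T * ((w.2 + 1 - w.1 : ℕ) : ℝ)) < |∑ l ∈ Finset.Icc w.1 w.2, η l ω|}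
  have hsub : {ω | ¬ NoiseBounded T (η · ω)} ⊆ ⋃ w ∈ windows, excess w := by
    intro ω hω
    simp only [NoiseBounded, Set.mem_ofPred_eq] at hω
    push Not at hω
    obtain ⟨s, t, hs, hst, ht, hlt⟩ := hω
    refine Set.mem_biUnion (x := (s, t)) ?_ hlt
    simp only [windows, Finset.coe_filter, Finset.mem_product, Finset.mem_Icc, Set.mem_ofPred_eq]
    omega
  have hexcess : ∀ w ∈ windows, P.real (excess w) ≤ 2 * Real.exp (-6 * Real.log T) := by
    intro w hw
    simp only [windows, Finset.mem_filter, Finset.mem_product, Finset.mem_Icc] at hw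
    exact hη.measureReal_lt_abs_sum_le hw.1.1.1 hw.2 (Real.log_natCast_nonneg T)
  have hcard : (windows.card : ℝ) ≤ (T : ℝ) ^ 2 := by
    have := Finset.card_filter_le (Finset.Icc 1 T ×ˢ Finset.Icc 1 T) fun w => w.1 ≤ w.2
    rw [Finset.card_product, Nat.card_Icc, Nat.add_sub_cancel, ← sq] at this
    exact_mod_cast this
  calc _ ≤ P.real (⋃ w ∈ windows, excess w) := measureReal_mono hsub (measure_ne_top _ _)
    _ ≤ ∑ w ∈ windows, P.real (excess w) := measureReal_biUnion_finset_le _ _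
    _ ≤ windows.card * (2 * Real.exp (-6 * Real.log T)) := by
        rw [← nsmul_eq_mul]
        exact Finset.sum_le_card_nsmul _ _ _ hexcess
    _ ≤ _ := mul_le_mul_of_nonneg_right hcard (by positivity)

end Concentration

section Means

variable {Ω : Type*} {mΩ : MeasurableSpace Ω} {P : Measure Ω} [IsProbabilityMeasure P]

lemma measureReal_forall_notMem_le_of_iIndepFun {ι E : Type*} [MeasurableSpace E] {X : ι → Ω → E}
    (hX : iIndepFun X P) (hXm : ∀ i, Measurable (X i)) {s : Set E} (hs : MeasurableSet s) {p : ℝ}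
    (hp : ∀ i, p ≤ P.real (X i ⁻¹' s)) (S : Finset ι) :
    P.real {ω | ∀ i ∈ S, X i ω ∉ s} ≤ Real.exp (-(p * S.card)) := by
  have hset : {ω | ∀ i ∈ S, X i ω ∉ s} = ⋂ i ∈ S, X i ⁻¹' sᶜ := by
    ext ω
    simp
  rw [hset, measureReal_def, hX.measure_inter_preimage_eq_mul S fun _ _ => hs.compl,
    ENNReal.toReal_prod]
  calc ∏ i ∈ S, (P (X i ⁻¹' sᶜ)).toReal
      ≤ ∏ _i ∈ S, Real.exp (-p) := by
        refine Finset.prod_le_prod (fun _ _ => ENNReal.toReal_nonneg) fun i _ => ?_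
        rw [Set.preimage_compl, ← measureReal_def, probReal_compl_eq_one_sub (hXm i hs)]
        linarith [hp i, Real.add_one_le_exp (-p)]
    _ = Real.exp (-(p * S.card)) := by
        rw [Finset.prod_const, ← Real.exp_nat_mul]
        ring_nf

lemma measureReal_exists_block_notMem_le {E : Type*} [MeasurableSpace E] {X : ℕ → Ω → E}
    (hX : iIndepFun X P) (hXm : ∀ k, Measurable (X k)) {s : Set E} (hs : MeasurableSet s) {p : ℝ}
    (hp : ∀ k, p ≤ P.real (X k ⁻¹' s)) (M B : ℕ) :
    P.real {ω | ¬ ∀ j < M, ∃ k ∈ Finset.Ico (j * B) ((j + 1) * B), X k ω ∈ s} ≤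
      M * Real.exp (-(p * B)) := by
  have hsub : {ω | ¬ ∀ j < M, ∃ k ∈ Finset.Ico (j * B) ((j + 1) * B), X k ω ∈ s} ⊆
      ⋃ j ∈ Finset.range M, {ω | ∀ k ∈ Finset.Ico (j * B) ((j + 1) * B), X k ω ∉ s} := by
    intro ω hω
    simp only [Set.mem_ofPred_eq] at hω
    push Not at hω
    obtain ⟨j, hj, hbad⟩ := hω
    exact Set.mem_biUnion (Finset.mem_coe.2 (Finset.mem_range.2 hj)) hbad
  calc _ ≤ P.real (⋃ j ∈ Finset.range M,
          {ω | ∀ k ∈ Finset.Ico (j * B) ((j + 1) * B), X k ω ∉ s}) :=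
        measureReal_mono hsub (measure_ne_top _ _)
    _ ≤ ∑ j ∈ Finset.range M, P.real {ω | ∀ k ∈ Finset.Ico (j * B) ((j + 1) * B), X k ω ∉ s} :=
        measureReal_biUnion_finset_le _ _
    _ ≤ ∑ _j ∈ Finset.range M, Real.exp (-(p * B)) := by
        refine Finset.sum_le_sum fun j _ => ?_
        refine (measureReal_forall_notMem_le_of_iIndepFun hX hXm hs hp _).trans_eq ?_
        rw [Nat.card_Ico, ← Nat.sub_mul, Nat.add_sub_cancel_left, one_mul]
    _ = M * Real.exp (-(p * B)) := by rw [Finset.sum_const, Finset.card_range, nsmul_eq_mul]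

variable {X : Ω → ℝ} {δ : ℝ}

lemma inv_max_mem_Icc (hδ : 0 < δ) (x : ℝ) : (max x δ)⁻¹ ∈ Set.Icc 0 δ⁻¹ :=
  ⟨inv_nonneg.2 (le_max_of_le_right hδ.le), inv_anti₀ hδ (le_max_right _ _)⟩

lemma integrable_inv_max (hX : Measurable X) (hδ : 0 < δ) :
    Integrable (fun ω => (max (X ω) δ)⁻¹) P :=
  Integrable.of_mem_Icc 0 δ⁻¹ (hX.max measurable_const).inv.aemeasurable
    (Filter.Eventually.of_forall fun ω => inv_max_mem_Icc hδ (X ω))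

lemma measureReal_lt_inv_max_le (hδ : 0 < δ) {K t : ℝ} (ht : 0 < t)
    (hK : ∀ x ∈ Set.Icc δ 1, P.real {ω | X ω < x} ≤ K * x) :
    P.real {ω | t < (max (X ω) δ)⁻¹} ≤ (Set.Ioc 0 1).indicator 1 t +
      (Set.Ioc 1 δ⁻¹).indicator (fun t => K * t⁻¹) t := by
  have hlt : ∀ ω, t < (max (X ω) δ)⁻¹ ↔ X ω < t⁻¹ ∧ δ < t⁻¹ := fun ω => by
    rw [lt_inv_comm₀ ht (lt_max_of_lt_right hδ), max_lt_iff]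
  simp only [hlt]
  rcases le_or_gt t 1 with ht1 | ht1
  · simp [ht, ht1, measureReal_le_one]
  rcases le_or_gt t δ⁻¹ with htδ | htδ
  · have htδ' : δ ≤ t⁻¹ := (le_inv_comm₀ ht hδ).1 htδ
    rw [Set.indicator_of_notMem (by simp [ht1]), Set.indicator_of_mem (by simp [ht1, htδ]),
      zero_add]
    exact (measureReal_mono fun ω hω => hω.1).trans (hK _ ⟨htδ', inv_le_one_of_one_le₀ ht1.le⟩)
  · have htδ' : ¬ δ < t⁻¹ := (inv_le_of_inv_le₀ hδ htδ.le).not_gt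
    simp [ht1.not_ge, htδ.not_ge, htδ']

lemma integral_inv_max_le (hX : Measurable X) (hδ : 0 < δ) (hδ1 : δ ≤ 1) {K : ℝ}
    (hK : ∀ x ∈ Set.Icc δ 1, P.real {ω | X ω < x} ≤ K * x) :
    ∫ ω, (max (X ω) δ)⁻¹ ∂P ≤ 1 + K * Real.log δ⁻¹ := by
  have hδ1' : 1 ≤ δ⁻¹ := (one_le_inv₀ hδ).2 hδ1
  have hone : Integrable ((Set.Ioc 0 1).indicator (1 : ℝ → ℝ)) :=
    (integrableOn_const (by simp)).integrable_indicator measurableSet_Ioc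
  have hinv : Integrable ((Set.Ioc 1 δ⁻¹).indicator fun t => K * t⁻¹) := by
    refine IntegrableOn.integrable_indicator ?_ measurableSet_Ioc
    rw [← intervalIntegrable_iff_integrableOn_Ioc_of_le hδ1']
    refine (intervalIntegral.intervalIntegrable_inv (fun t ht => ?_) continuousOn_id).const_mul K
    rw [Set.uIcc_of_le hδ1'] at ht
    exact (zero_lt_one.trans_le ht.1).ne'
  rw [(integrable_inv_max hX hδ).integral_eq_integral_meas_lt
    (Filter.Eventually.of_forall fun ω => (inv_max_mem_Icc hδ (X ω)).1)]
  calc ∫ t in Set.Ioi 0, P.real {ω | t < (max (X ω) δ)⁻¹}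
      ≤ ∫ t in Set.Ioi 0, ((Set.Ioc 0 1).indicator 1 t +
          (Set.Ioc 1 δ⁻¹).indicator (fun t => K * t⁻¹) t) :=
        integral_mono_of_nonneg (Filter.Eventually.of_forall fun _ => measureReal_nonneg)
          (hone.add hinv).integrableOn <| (ae_restrict_iff' measurableSet_Ioi).2 <|
            Filter.Eventually.of_forall fun t ht => measureReal_lt_inv_max_le hδ ht hK
    _ = (∫ t in (0 : ℝ)..1, 1) + ∫ t in (1 : ℝ)..δ⁻¹, K * t⁻¹ := by
        rw [integral_add hone.integrableOn hinv.integrableOn,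
          setIntegral_indicator measurableSet_Ioc, setIntegral_indicator measurableSet_Ioc,
          Set.inter_eq_self_of_subset_right Set.Ioc_subset_Ioi_self,
          Set.inter_eq_self_of_subset_right
            (Set.Ioc_subset_Ioi_self.trans (Set.Ioi_subset_Ioi zero_le_one)),
          intervalIntegral.integral_of_le zero_le_one, intervalIntegral.integral_of_le hδ1']
        rfl
    _ = 1 + K * Real.log δ⁻¹ := by
        rw [intervalIntegral.integral_const_mul, integral_inv_of_pos one_pos (inv_pos.2 hδ)]
        simp

end Means

section Measurability

variable {Ω : Type*} [MeasurableSpace Ω] {T : ℕ} {δ : ℝ} {m ρ r : ℕ → Ω → ℝ} {κ τ : ℕ → Ω → ℕ}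

lemma measurable_gap (hm : ∀ k, Measurable (m k)) (hρ : ∀ u, 1 ≤ u → Measurable (ρ u)) {t : ℕ}
    (hκ : ∀ s ≤ t, Measurable (κ s)) :
    Measurable fun ω => gap (m · ω) (ρ · ω) (κ · ω) t := by
  have hmean : Measurable fun ω => m (κ t ω) ω :=
    (measurable_from_prod_countable_right (f := fun p : ℕ × Ω => m p.1 p.2) hm).comp
      ((hκ t le_rfl).prodMk measurable_id)
  refine (hmean.const_sub 1).add (Finset.measurable_fun_sum _ fun u hu => ?_)
  rw [Finset.mem_Ico] at hu
  exact Measurable.ite (measurableSet_eq_fun (hκ u hu.2.le) (hκ t le_rfl)) (hρ u hu.1)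
    measurable_const

lemma measurableSet_withdraws {t : ℕ} (hr : ∀ l ∈ Finset.Icc 1 t, Measurable (r l))
    (hτ : Measurable (τ t)) : MeasurableSet {ω | Withdraws T δ (r · ω) (τ · ω) t} := by
  have hset : {ω | Withdraws T δ (r · ω) (τ · ω) t} = ⋃ s, ⋃ _ : 1 ≤ s,
      (τ t ⁻¹' {n | s ∈ windowStarts T n (t + 1)}) ∩ {ω | windowUCB T (r · ω) s t < 1 - δ} := by
    ext ω
    simp only [Withdraws, Set.mem_iUnion]
    exact exists_congr fun s => ⟨fun h => ⟨h.1.1, h⟩, fun ⟨_, h⟩ => h⟩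
  rw [hset]
  refine MeasurableSet.iUnion fun s => MeasurableSet.iUnion fun hs =>
    (hτ MeasurableSet.of_discrete).inter (measurableSet_lt ?_ measurable_const)
  refine ((Finset.measurable_fun_sum _ fun l hl => hr l ?_).div_const _).add_const _
  exact Finset.Icc_subset_Icc_left hs hl

lemma measurable_idx_start_of_isRun
    (hr : ∀ l, 1 ≤ l → (∀ s ≤ l, Measurable (κ s)) → Measurable (r l))
    (h : ∀ ω, IsRun T δ (r · ω) (κ · ω) (τ · ω)) (t : ℕ) :
    ∀ s ≤ t, Measurable (κ s) ∧ Measurable (τ s) := by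
  induction t with
  | zero =>
    intro s hs
    obtain rfl := Nat.le_zero.1 hs
    rw [show κ 0 = fun _ => 0 from funext fun ω => (h ω).idx_zero,
      show τ 0 = fun _ => 1 from funext fun ω => (h ω).start_zero]
    exact ⟨measurable_const, measurable_const⟩
  | succ t ih =>
    intro s hs
    rcases Nat.of_le_succ hs with hs | rfl
    · exact ih s hs
    have hW : MeasurableSet {ω | Withdraws T δ (r · ω) (τ · ω) t} :=
      measurableSet_withdraws (fun l hl => hr l (Finset.mem_Icc.1 hl).1 fun s hs =>
        (ih s (hs.trans (Finset.mem_Icc.1 hl).2)).1) (ih t le_rfl).2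
    classical
    have hκ : κ (t + 1) = fun ω =>
        if Withdraws T δ (r · ω) (τ · ω) t then κ t ω + 1 else κ t ω := by
      funext ω
      rcases (h ω).step t with hstep | hstep <;> simp [hstep]
    have hτ : τ (t + 1) = fun ω =>
        if Withdraws T δ (r · ω) (τ · ω) t then t + 1 else τ t ω := by
      funext ω
      rcases (h ω).step t with hstep | hstep <;> simp [hstep]
    rw [Nat.succ_eq_add_one, hκ, hτ]
    exact ⟨Measurable.ite hW ((ih t le_rfl).1.add_const 1) (ih t le_rfl).1,
      Measurable.ite hW measurable_const (ih t le_rfl).2⟩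

lemma measurable_runIdx {A : Type*} {sel : ℕ → A} {μ₁ : A → Ω → ℝ} {η : ℕ → Ω → ℝ}
    (hsel : Function.Injective sel) (hμ : ∀ a, Measurable (μ₁ a))
    (hρ : ∀ u, 1 ≤ u → Measurable (ρ u)) (hη : ∀ u, 1 ≤ u → Measurable (η u)) (t : ℕ) :
    Measurable fun ω => runIdx sel T δ (μ₁ · ω) (ρ · ω) (η · ω) t :=
  (measurable_idx_start_of_isRun (T := T) (δ := δ)
    (r := fun l ω => 1 - runGap sel T δ (μ₁ · ω) (ρ · ω) (η · ω) l + η l ω)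
    (κ := fun l ω => runIdx sel T δ (μ₁ · ω) (ρ · ω) (η · ω) l)
    (τ := fun l ω => runStart sel T δ (μ₁ · ω) (ρ · ω) (η · ω) l)
    (fun l hl hκ => ((measurable_gap (fun k => hμ (sel k)) hρ hκ).const_sub 1).add (hη l hl))
    (fun _ => isRun_run hsel) t t le_rfl).1

lemma measurable_regret {A : Type*} {sel : ℕ → A} {μ₁ : A → Ω → ℝ} {η : ℕ → Ω → ℝ}
    (hsel : Function.Injective sel) (hμ : ∀ a, Measurable (μ₁ a))
    (hρ : ∀ u, 1 ≤ u → Measurable (ρ u)) (hη : ∀ u, 1 ≤ u → Measurable (η u)) :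
    Measurable fun ω => regret sel T δ (μ₁ · ω) (ρ · ω) (η · ω) := by
  simp only [regret_eq_sum_runGap hsel]
  exact Finset.measurable_fun_sum _ fun t _ => measurable_gap (fun k => hμ (sel k)) hρ
    fun s _ => measurable_runIdx hsel hμ hρ hη s

end Measurability

lemma integral_le_integral_add_mul_measureReal {Ω : Type*} {mΩ : MeasurableSpace Ω}
    {P : Measure Ω} [IsFiniteMeasure P] {f g : Ω → ℝ} {c : ℝ} {E : Set Ω} (hf : Integrable f P)
    (hg : Integrable g P) (hg0 : 0 ≤ᵐ[P] g) (hfc : ∀ᵐ ω ∂P, f ω ≤ c)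
    (hfg : ∀ᵐ ω ∂P, ω ∉ E → f ω ≤ g ω) : ∫ ω, f ω ∂P ≤ ∫ ω, g ω ∂P + c * P.real E := by
  have hEm : MeasurableSet (toMeasurable P E) := measurableSet_toMeasurable P E
  have hind : Integrable ((toMeasurable P E).indicator fun _ => c) P :=
    (integrable_const c).indicator hEm
  have hle : f ≤ᵐ[P] g + (toMeasurable P E).indicator fun _ => c := by
    filter_upwards [hg0, hfc, hfg] with ω hω0 hωc hωg
    simp only [Pi.add_apply, Pi.zero_apply] at hω0 ⊢
    by_cases hω : ω ∈ toMeasurable P E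
    · rw [Set.indicator_of_mem hω]
      linarith
    · rw [Set.indicator_of_notMem hω, add_zero]
      exact hωg fun hE => hω (subset_toMeasurable P E hE)
  calc ∫ ω, f ω ∂P ≤ ∫ ω, (g + (toMeasurable P E).indicator fun _ => c) ω ∂P :=
        integral_mono_ae hf (hg.add hind) hle
    _ = ∫ ω, g ω ∂P + c * P.real E := by
        rw [integral_add' hg hind, integral_indicator_const c hEm, measureReal_def,
          measure_toMeasurable, ← measureReal_def, smul_eq_mul, mul_comm]

/-- The slow rotting environment for an adversary that may anticipate the future, and for initial
means that are independent but need not share their law. The filtration `ℱ` only has to carry the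
noise. -/
structure IsAnticipatingRotting {A Ω : Type*} [mΩ : MeasurableSpace Ω] (P : Measure Ω)
    (ℱ : Filtration ℕ mΩ) (β cL cU : ℝ) (T : ℕ) (V : ℝ)
    (μ₁ : A → Ω → ℝ) (ρ η : ℕ → Ω → ℝ) : Prop where
  mean_measurable : ∀ a, Measurable (μ₁ a)
  mean_indep : iIndepFun μ₁ P
  mean_mem : ∀ a, ∀ᵐ ω ∂P, μ₁ a ω ∈ Set.Icc (0 : ℝ) 1
  mean_lower : ∀ a, ∀ x ∈ Set.Icc (0 : ℝ) 1, cL * x ^ β ≤ P.real {ω | 1 - x < μ₁ a ω}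
  mean_upper : ∀ a, ∀ x ∈ Set.Icc (0 : ℝ) 1, P.real {ω | 1 - x < μ₁ a ω} ≤ cU * x ^ β
  noise : IsSubGaussianNoise P ℱ η
  rot_measurable : ∀ t, 1 ≤ t → Measurable (ρ t)
  rot_nonneg : ∀ t, 1 ≤ t → ∀ᵐ ω ∂P, 0 ≤ ρ t ω
  rot_budget : ∀ᵐ ω ∂P, ∑ t ∈ Finset.Ico 1 T, ρ t ω ≤ V

section Environment

variable {A Ω : Type*} [mΩ : MeasurableSpace Ω] {P : Measure Ω} {ℱ : Filtration ℕ mΩ}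
  {β cL cU V δ : ℝ} {T : ℕ} {μ₁ : A → Ω → ℝ} {ρ η : ℕ → Ω → ℝ} {sel : ℕ → A}

lemma IsSlowRotting.isAnticipatingRotting (h : IsSlowRotting P ℱ β cL cU T V μ₁ ρ η) :
    IsAnticipatingRotting P ℱ β cL cU T V μ₁ ρ η where
  mean_measurable a := (h.mean_measurable a).mono (ℱ.le 0) le_rfl
  mean_indep := h.mean_indep
  mean_mem := h.mean_mem
  mean_lower := h.mean_lower
  mean_upper := h.mean_upper
  noise := ⟨h.noise_measurable, h.noise_integrable, h.noise_subGaussian⟩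
  rot_measurable t ht := (h.rot_measurable t ht).mono (ℱ.le t) le_rfl
  rot_nonneg := h.rot_nonneg
  rot_budget := by
    rw [show Finset.Ico 1 T = Finset.Icc 1 (T - 1) by ext; simp; omega]
    exact h.rot_budget

lemma IsAnticipatingRotting.ae_admissible (h : IsAnticipatingRotting P ℱ β cL cU T V μ₁ ρ η)
    (sel : ℕ → A) : ∀ᵐ ω ∂P, (∀ k, μ₁ (sel k) ω ∈ Set.Icc (0 : ℝ) 1) ∧
      (∀ u, 1 ≤ u → 0 ≤ ρ u ω) ∧ ∑ u ∈ Finset.Ico 1 T, ρ u ω ≤ V := by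
  have hmean : ∀ᵐ ω ∂P, ∀ k, μ₁ (sel k) ω ∈ Set.Icc (0 : ℝ) 1 :=
    ae_all_iff.2 fun k => h.mean_mem (sel k)
  have hrot : ∀ᵐ ω ∂P, ∀ u, 1 ≤ u → 0 ≤ ρ u ω :=
    ae_all_iff.2 fun u => Filter.eventually_imp_distrib_left.2 (h.rot_nonneg u)
  filter_upwards [hmean, hrot, h.rot_budget] with ω hmω hρω hVω using ⟨hmω, hρω, hVω⟩

lemma IsAnticipatingRotting.ae_regret_mem_Icc
    (h : IsAnticipatingRotting P ℱ β cL cU T V μ₁ ρ η) (hsel : Function.Injective sel) :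
    ∀ᵐ ω ∂P, regret sel T δ (μ₁ · ω) (ρ · ω) (η · ω) ∈ Set.Icc 0 (T * (1 + V)) := by
  filter_upwards [h.ae_admissible sel] with ω ⟨hm, hρ, hV⟩
  rw [regret_eq_sum_runGap hsel]
  constructor
  · exact Finset.sum_nonneg fun t _ =>
      (sub_nonneg.2 (hm _).2).trans (initial_gap_le_gap (m := fun k => μ₁ (sel k) ω) hρ t)
  · refine (Finset.sum_le_card_nsmul _ _ (1 + V) fun t ht => ?_).trans_eq ?_
    · exact (gap_le hρ (fun k => (hm k).1) (Finset.mem_Icc.1 ht).2).trans (by linarith)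
    · simp [mul_add]

lemma IsAnticipatingRotting.ae_regret_le_of_noiseBounded_of_blocks
    (h : IsAnticipatingRotting P ℱ β cL cU T V μ₁ ρ η) (hsel : Function.Injective sel)
    (hδ : 0 < δ) (hδ1 : δ ≤ 1) (hT : 1 ≤ T) {M B : ℕ} (hM : V < M * (δ / 2)) :
    ∀ᵐ ω ∂P, NoiseBounded T (η · ω) →
      (∀ j < M, ∃ k ∈ Finset.Ico (j * B) ((j + 1) * B), 1 - δ / 2 < μ₁ (sel k) ω) →
      regret sel T δ (μ₁ · ω) (ρ · ω) (η · ω) ≤ 2 * δ * T + V +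
        400 * (1 + Real.log T) * ∑ k ∈ Finset.range (M * B), (max (1 - μ₁ (sel k) ω) δ)⁻¹ := by
  filter_upwards [h.ae_admissible sel] with ω ⟨hm, hρ, hV⟩ hη hB
  rw [regret_eq_sum_runGap hsel]
  have hrun := isRun_run (T := T) (δ := δ) (μ₁ := (μ₁ · ω)) (ρ := (ρ · ω)) (η := (η · ω)) hsel
  rw [runGap] at hrun
  have hregret := hrun.sum_gap_le_of_blocks hη hρ (fun k => (hm k).1) hδ hδ1 hT
    (hV.trans_lt hM) hB
  rw [runGap]
  linarith

variable [IsProbabilityMeasure P]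

lemma IsAnticipatingRotting.integrable_regret
    (h : IsAnticipatingRotting P ℱ β cL cU T V μ₁ ρ η) (hsel : Function.Injective sel) :
    Integrable (fun ω => regret sel T δ (μ₁ · ω) (ρ · ω) (η · ω)) P :=
  Integrable.of_mem_Icc 0 (T * (1 + V))
    (measurable_regret hsel h.mean_measurable h.rot_measurable fun t ht =>
      (h.noise.measurable t ht).mono (ℱ.le t) le_rfl).aemeasurable (h.ae_regret_mem_Icc hsel)

lemma IsAnticipatingRotting.measureReal_exists_bad_block_le
    (h : IsAnticipatingRotting P ℱ β cL cU T V μ₁ ρ η) (hsel : Function.Injective sel) {x : ℝ}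
    (hx : x ∈ Set.Icc 0 1) (M B : ℕ) :
    P.real {ω | ¬ ∀ j < M, ∃ k ∈ Finset.Ico (j * B) ((j + 1) * B), 1 - x < μ₁ (sel k) ω} ≤
      M * Real.exp (-(cL * x ^ β * B)) :=
  measureReal_exists_block_notMem_le (X := fun k => μ₁ (sel k)) (h.mean_indep.precomp hsel)
    (fun k => h.mean_measurable (sel k)) (measurableSet_Ioi (a := 1 - x))
    (fun k => h.mean_lower (sel k) x hx) M B

lemma IsAnticipatingRotting.integrable_inv_max_gap
    (h : IsAnticipatingRotting P ℱ β cL cU T V μ₁ ρ η) (hδ : 0 < δ) (a : A) :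
    Integrable (fun ω => (max (1 - μ₁ a ω) δ)⁻¹) P :=
  integrable_inv_max ((h.mean_measurable a).const_sub 1) hδ

lemma IsAnticipatingRotting.integral_inv_max_gap_le
    (h : IsAnticipatingRotting P ℱ β cL cU T V μ₁ ρ η) (hcU : 0 ≤ cU) (hδ : 0 < δ) (hδ1 : δ ≤ 1)
    {b : ℝ} (hb : 1 ≤ b) (hβb : β ≤ b) (a : A) :
    ∫ ω, (max (1 - μ₁ a ω) δ)⁻¹ ∂P ≤ 1 + cU * δ ^ (β - b) * Real.log δ⁻¹ := by
  refine integral_inv_max_le ((h.mean_measurable a).const_sub 1) hδ hδ1 fun x hx => ?_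
  have hx0 : 0 < x := hδ.trans_le hx.1
  have hpow : x ^ β ≤ δ ^ (β - b) * x := by
    calc x ^ β = x ^ (β - b) * x ^ b := by rw [← Real.rpow_add hx0, sub_add_cancel]
      _ ≤ δ ^ (β - b) * x ^ (1 : ℝ) := by
        gcongr ?_ * ?_
        · exact Real.rpow_le_rpow_of_nonpos hδ hx.1 (sub_nonpos.2 hβb)
        · exact Real.rpow_le_rpow_of_exponent_ge hx0 hx.2 hb
      _ = δ ^ (β - b) * x := by rw [Real.rpow_one]
  calc P.real {ω | 1 - μ₁ a ω < x} = P.real {ω | 1 - x < μ₁ a ω} := by simp only [sub_lt_comm]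
    _ ≤ cU * x ^ β := h.mean_upper a x ⟨hx0.le, hx.2⟩
    _ ≤ cU * δ ^ (β - b) * x := by
        rw [mul_assoc]
        exact mul_le_mul_of_nonneg_left hpow hcU

lemma IsAnticipatingRotting.integral_sum_inv_max_gap_le
    (h : IsAnticipatingRotting P ℱ β cL cU T V μ₁ ρ η) (hcU : 0 ≤ cU) (hδ : 0 < δ) (hδ1 : δ ≤ 1)
    {b : ℝ} (hb : 1 ≤ b) (hβb : β ≤ b) (sel : ℕ → A) (N : ℕ) :
    ∫ ω, ∑ k ∈ Finset.range N, (max (1 - μ₁ (sel k) ω) δ)⁻¹ ∂P ≤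
      N * (1 + cU * δ ^ (β - b) * Real.log δ⁻¹) := by
  rw [integral_finsetSum _ fun k _ => h.integrable_inv_max_gap hδ (sel k)]
  refine (Finset.sum_le_card_nsmul _ _ _ fun k _ =>
    h.integral_inv_max_gap_le hcU hδ hδ1 hb hβb (sel k)).trans_eq ?_
  rw [Finset.card_range, nsmul_eq_mul]

lemma IsAnticipatingRotting.integral_regret_le
    (h : IsAnticipatingRotting P ℱ β cL cU T V μ₁ ρ η) (hsel : Function.Injective sel)
    (hcU : 0 ≤ cU) (hV : 0 ≤ V) (hδ : 0 < δ) (hδ1 : δ ≤ 1) (hT : 1 ≤ T) {b : ℝ} (hb : 1 ≤ b)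
    (hβb : β ≤ b) {M B : ℕ} (hM : V < M * (δ / 2)) :
    ∫ ω, regret sel T δ (μ₁ · ω) (ρ · ω) (η · ω) ∂P ≤ 2 * δ * T + V +
      400 * (1 + Real.log T) * (M * B * (1 + cU * δ ^ (β - b) * Real.log δ⁻¹)) +
      T * (1 + V) * (T ^ 2 * (2 * Real.exp (-6 * Real.log T)) +
        M * Real.exp (-(cL * (δ / 2) ^ β * B))) := by
  let cost (ω : Ω) : ℝ := ∑ k ∈ Finset.range (M * B), (max (1 - μ₁ (sel k) ω) δ)⁻¹
  have hcost0 : ∀ ω, 0 ≤ cost ω := fun ω =>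
    Finset.sum_nonneg fun k _ => (inv_max_mem_Icc hδ _).1
  have hcost : Integrable cost P := integrable_finsetSum _ fun k _ =>
    h.integrable_inv_max_gap hδ (sel k)
  let noisy : Set Ω := {ω | ¬ NoiseBounded T (η · ω)}
  let poor : Set Ω :=
    {ω | ¬ ∀ j < M, ∃ k ∈ Finset.Ico (j * B) ((j + 1) * B), 1 - δ / 2 < μ₁ (sel k) ω}
  have hfail : P.real (noisy ∪ poor) ≤ T ^ 2 * (2 * Real.exp (-6 * Real.log T)) +
      M * Real.exp (-(cL * (δ / 2) ^ β * B)) :=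
    (measureReal_union_le _ _).trans (add_le_add (h.noise.measureReal_not_noiseBounded_le T)
      (h.measureReal_exists_bad_block_le hsel ⟨by linarith, by linarith⟩ M B))
  have hgood : ∀ᵐ ω ∂P, ω ∉ noisy ∪ poor → regret sel T δ (μ₁ · ω) (ρ · ω) (η · ω) ≤
      2 * δ * T + V + 400 * (1 + Real.log T) * cost ω := by
    filter_upwards [h.ae_regret_le_of_noiseBounded_of_blocks hsel hδ hδ1 hT (B := B) hM]
      with ω hω hE
    exact hω (not_not.1 fun hη => hE (Or.inl hη)) (not_not.1 fun hB => hE (Or.inr hB))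
  calc ∫ ω, regret sel T δ (μ₁ · ω) (ρ · ω) (η · ω) ∂P
      ≤ ∫ ω, (2 * δ * T + V + 400 * (1 + Real.log T) * cost ω) ∂P +
          T * (1 + V) * P.real (noisy ∪ poor) :=
        integral_le_integral_add_mul_measureReal (h.integrable_regret hsel)
          ((integrable_const _).add (hcost.const_mul _))
          (Filter.Eventually.of_forall fun ω => by have := hcost0 ω; positivity)
          ((h.ae_regret_mem_Icc hsel).mono fun ω hω => hω.2) hgood
    _ = 2 * δ * T + V + 400 * (1 + Real.log T) * ∫ ω, cost ω ∂P +
          T * (1 + V) * P.real (noisy ∪ poor) := by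
        rw [integral_add (integrable_const _) (hcost.const_mul _), integral_const_mul]
        simp
    _ ≤ _ := by
        have hint := h.integral_sum_inv_max_gap_le hcU hδ hδ1 hb hβb sel (M * B)
        rw [Nat.cast_mul] at hint
        gcongr

end Environment
/-- The order of the optimal threshold when the cost of exploring a single arm is of order
`δ ^ (-b)`, where `b = max β 1`; the regret is then of order `T * rate b V T`. -/
noncomputable def rate (b V : ℝ) (T : ℕ) : ℝ :=
  max ((V / T) ^ (1 / (b + 2))) (1 / (T : ℝ) ^ (1 / (b + 1)))

section Rate

variable {b c₁ V : ℝ} {T : ℕ}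

lemma rate_pos (hT : 1 ≤ T) : 0 < rate b V T := by
  exact lt_max_of_lt_right (by positivity)

lemma rate_le_one (hb : 0 ≤ b) (hT : 1 ≤ T) (hV : 0 ≤ V) (hVT : V ≤ T) : rate b V T ≤ 1 := by
  have hT1 : (1 : ℝ) ≤ T := Nat.one_le_cast.2 hT
  refine max_le (Real.rpow_le_one (by positivity) (div_le_one_of_le₀ hVT (by positivity))
    (by positivity)) ?_
  exact div_le_one_of_le₀ (Real.one_le_rpow hT1 (by positivity)) (by positivity)

lemma budget_le_mul_rate_rpow (hb : 0 ≤ b) (hT : 1 ≤ T) (hV : 0 ≤ V) :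
    V ≤ T * rate b V T ^ (b + 2) := by
  have hT0 : (0 : ℝ) < T := Nat.cast_pos.2 hT
  have hpow : ((V / T) ^ (1 / (b + 2))) ^ (b + 2) ≤ rate b V T ^ (b + 2) :=
    Real.rpow_le_rpow (by positivity) (le_max_left _ _) (by linarith)
  rwa [← Real.rpow_mul (by positivity), one_div_mul_cancel (by linarith), Real.rpow_one,
    div_le_iff₀' hT0] at hpow

lemma one_le_mul_rate_rpow (hb : 0 ≤ b) (hT : 1 ≤ T) : 1 ≤ T * rate b V T ^ (b + 1) := by
  have hT0 : (0 : ℝ) < T := Nat.cast_pos.2 hT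
  have hpow : (1 / (T : ℝ) ^ (1 / (b + 1))) ^ (b + 1) ≤ rate b V T ^ (b + 1) :=
    Real.rpow_le_rpow (by positivity) (le_max_right _ _) (by linarith)
  rwa [Real.div_rpow zero_le_one (by positivity), Real.one_rpow, ← Real.rpow_mul hT0.le,
    one_div_mul_cancel (by linarith), Real.rpow_one, div_le_iff₀' hT0] at hpow

lemma rate_rpow_le (hT : 1 ≤ T) (hb : 0 ≤ b) (hV : 0 ≤ V) (hVT : V ≤ T) {p : ℝ} (hp : 1 ≤ p) :
    rate b V T ^ p ≤ rate b V T := by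
  simpa using Real.rpow_le_rpow_of_exponent_ge (rate_pos hT) (rate_le_one hb hT hV hVT) hp

lemma budget_le_mul_rate (hb : 0 ≤ b) (hT : 1 ≤ T) (hV : 0 ≤ V) (hVT : V ≤ T) :
    V ≤ T * rate b V T :=
  (budget_le_mul_rate_rpow hb hT hV).trans <|
    mul_le_mul_of_nonneg_left (rate_rpow_le hT hb hV hVT (by linarith)) T.cast_nonneg

lemma one_le_mul_rate (hb : 0 ≤ b) (hT : 1 ≤ T) (hV : 0 ≤ V) (hVT : V ≤ T) :
    1 ≤ T * rate b V T :=
  (one_le_mul_rate_rpow hb hT).trans <|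
    mul_le_mul_of_nonneg_left (rate_rpow_le hT hb hV hVT (by linarith)) T.cast_nonneg

lemma mul_rate (hb : 0 ≤ b) (hT : 1 ≤ T) (hV : 0 ≤ V) :
    T * rate b V T = max (V ^ (1 / (b + 2)) * (T : ℝ) ^ ((b + 1) / (b + 2)))
      ((T : ℝ) ^ (b / (b + 1))) := by
  have hT0 : (0 : ℝ) < T := Nat.cast_pos.2 hT
  rw [rate, mul_max_of_nonneg _ _ hT0.le]
  congr 1
  · rw [Real.div_rpow hV hT0.le, show (b + 1) / (b + 2) = 1 - 1 / (b + 2) by field_simp; ring,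
      Real.rpow_sub hT0, Real.rpow_one]
    ring
  · rw [show b / (b + 1) = 1 - 1 / (b + 1) by field_simp; ring, Real.rpow_sub hT0, Real.rpow_one]
    ring

lemma budget_div_add_one_mul_rpow_le (hb : 0 ≤ b) (hT : 1 ≤ T) (hV : 0 ≤ V) (hc₁ : 0 < c₁) :
    (V / (c₁ * rate b V T) + 1) * (c₁ * rate b V T) ^ (-b) ≤
      (c₁ ^ (-b - 1) + c₁ ^ (-b)) * (T * rate b V T) := by
  have hbudget := budget_le_mul_rate_rpow hb hT hV
  have hone := one_le_mul_rate_rpow (V := V) hb hT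
  have hg := rate_pos (b := b) (V := V) hT
  generalize rate b V T = g at *
  have hrotted : V * g ^ (-b - 1) ≤ T * g := by
    refine (mul_le_mul_of_nonneg_right hbudget (by positivity)).trans_eq ?_
    rw [mul_assoc, ← Real.rpow_add hg, show b + 2 + (-b - 1) = 1 by ring, Real.rpow_one]
  have hfresh : g ^ (-b) ≤ T * g := by
    refine (le_mul_of_one_le_left (by positivity) hone).trans_eq ?_
    rw [mul_assoc, ← Real.rpow_add hg, show b + 1 + -b = 1 by ring, Real.rpow_one]
  calc (V / (c₁ * g) + 1) * (c₁ * g) ^ (-b)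
      = c₁ ^ (-b - 1) * (V * g ^ (-b - 1)) + c₁ ^ (-b) * g ^ (-b) := by
        rw [Real.mul_rpow hc₁.le hg.le, Real.rpow_sub_one hc₁.ne', Real.rpow_sub_one hg.ne']
        field_simp
    _ ≤ c₁ ^ (-b - 1) * (T * g) + c₁ ^ (-b) * (T * g) := by gcongr
    _ = _ := by ring

lemma deltaV_eq_mul_rate (c₁ β V : ℝ) (T : ℕ) : deltaV c₁ β V T = c₁ * rate (max β 1) V T := by
  rcases le_or_gt 1 β with hβ | hβ
  · rw [deltaV, if_pos hβ, max_eq_left hβ, rate]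
  · rw [deltaV, if_neg hβ.not_ge, max_eq_right hβ.le, rate, Real.sqrt_eq_rpow]
    norm_num

end Rate

section Parameters

variable {β b c₁ cL cU δ L V : ℝ}

lemma natCeil_div_le_mul_rpow (hβ : 0 ≤ β) (hcL : 0 < cL) (hδ : 0 < δ) (hδ1 : δ ≤ 1)
    (hL : 0 ≤ L) :
    (⌈4 * L / (cL * (δ / 2) ^ β)⌉₊ : ℝ) ≤ (4 * 2 ^ β / cL + 1) * (1 + L) * δ ^ (-β) := by
  have hδβ : 1 ≤ δ ^ (-β) := Real.one_le_rpow_of_pos_of_le_one_of_nonpos hδ hδ1 (by linarith)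
  calc (⌈4 * L / (cL * (δ / 2) ^ β)⌉₊ : ℝ) ≤ 4 * L / (cL * (δ / 2) ^ β) + 1 :=
        (Nat.ceil_lt_add_one (by positivity)).le
    _ = 4 * 2 ^ β / cL * L * δ ^ (-β) + 1 := by
        rw [Real.div_rpow hδ.le zero_le_two, Real.rpow_neg hδ.le]
        field_simp
    _ ≤ 4 * 2 ^ β / cL * L * δ ^ (-β) + δ ^ (-β) := by gcongr
    _ ≤ 4 * 2 ^ β / cL * L * δ ^ (-β) + δ ^ (-β) + (4 * 2 ^ β / cL + L) * δ ^ (-β) :=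
        le_add_of_nonneg_right (by positivity)
    _ = _ := by ring

lemma one_add_mul_log_inv_le {x y : ℝ} (hcU : 0 ≤ cU) (hc₁ : 0 < c₁) (hc₁' : c₁ ≤ 1) (hδ : 0 < δ)
    (hx : 1 ≤ x) (hy : 1 ≤ y) (hδx : c₁ ≤ x * δ) :
    1 + cU * y * Real.log δ⁻¹ ≤
      (1 + cU * (1 + Real.log c₁⁻¹)) * (1 + Real.log x) * y := by
  have hx0 : 0 < x := by linarith
  have hlogx : 0 ≤ Real.log x := Real.log_nonneg hx
  have hlogc : 0 ≤ Real.log c₁⁻¹ := Real.log_nonneg ((one_le_inv₀ hc₁).2 hc₁')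
  have hlog : Real.log δ⁻¹ ≤ Real.log x + Real.log c₁⁻¹ := by
    rw [← Real.log_mul hx0.ne' (inv_pos.2 hc₁).ne']
    refine Real.log_le_log (inv_pos.2 hδ) ?_
    rwa [inv_le_comm₀ hδ (by positivity), mul_inv, inv_inv, inv_mul_le_iff₀ hx0]
  calc 1 + cU * y * Real.log δ⁻¹
      ≤ (1 + Real.log x) * y +
          cU * y * ((1 + Real.log c₁⁻¹) * (1 + Real.log x)) := by
        gcongr
        · nlinarith
        · nlinarith
    _ = _ := by ring

lemma exp_neg_le_one_div_pow {x y : ℝ} (hx : 0 < x) (n : ℕ) (hy : n * Real.log x ≤ y) :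
    Real.exp (-y) ≤ 1 / x ^ n := by
  calc Real.exp (-y) ≤ Real.exp (-(n * Real.log x)) := Real.exp_le_exp.2 (neg_le_neg hy)
    _ = 1 / x ^ n := by rw [Real.exp_neg, Real.exp_nat_mul, Real.exp_log hx, one_div]

lemma failure_cost_le {T M p B : ℝ} (hT : 1 ≤ T) (hV : 0 ≤ V) (hVT : V ≤ T) (hc₁ : 0 < c₁)
    (hδ : 0 < δ) (hδT : c₁ ≤ T * δ) (hM : M ≤ 2 * V / δ + 1) (hB : 4 * Real.log T ≤ p * B) :
    T * (1 + V) * (T ^ 2 * (2 * Real.exp (-6 * Real.log T)) + M * Real.exp (-(p * B))) ≤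
      6 + 4 / c₁ := by
  have hT0 : 0 < T := by linarith
  have hexp6 : Real.exp (-6 * Real.log T) ≤ 1 / T ^ 6 := by
    rw [neg_mul]
    exact exp_neg_le_one_div_pow hT0 6 le_rfl
  have hexp4 : Real.exp (-(p * B)) ≤ 1 / T ^ 4 := exp_neg_le_one_div_pow hT0 4 hB
  have hδinv : δ⁻¹ ≤ T / c₁ := by
    rwa [le_div_iff₀ hc₁, inv_mul_le_iff₀ hδ, mul_comm δ]
  have hM' : M ≤ (2 / c₁ + 1) * T ^ 2 := by
    calc M ≤ 2 * V * δ⁻¹ + 1 := by rwa [← div_eq_mul_inv]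
      _ ≤ 2 * T * (T / c₁) + T ^ 2 := by
          gcongr
          exact one_le_pow₀ hT
      _ = (2 / c₁ + 1) * T ^ 2 := by ring
  calc _ ≤ T * (1 + V) * (T ^ 2 * (2 * (1 / T ^ 6)) + (2 / c₁ + 1) * T ^ 2 * (1 / T ^ 4)) := by
        gcongr
    _ ≤ T * (2 * T) * (T ^ 2 * (2 * (1 / T ^ 6)) + (2 / c₁ + 1) * T ^ 2 * (1 / T ^ 4)) := by
        gcongr
        linarith
    _ = 4 * (1 / T ^ 2) + 2 * (2 / c₁ + 1) := by field_simp; ring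
    _ ≤ 4 * 1 + 2 * (2 / c₁ + 1) := by
        gcongr
        exact (div_le_one (by positivity)).2 (one_le_pow₀ hT)
    _ = _ := by ring

variable {A Ω : Type*} {mΩ : MeasurableSpace Ω} {P : Measure Ω} [IsProbabilityMeasure P]
  {ℱ : Filtration ℕ mΩ} {T : ℕ} {μ₁ : A → Ω → ℝ} {ρ η : ℕ → Ω → ℝ} {sel : ℕ → A}

lemma IsAnticipatingRotting.integral_regret_le_rpow
    (h : IsAnticipatingRotting P ℱ β cL cU T V μ₁ ρ η) (hsel : Function.Injective sel)
    (hβ : 0 ≤ β) (hb : 1 ≤ b) (hβb : β ≤ b) (hc₁ : 0 < c₁) (hc₁' : c₁ ≤ 1) (hcL : 0 < cL)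
    (hcU : 0 ≤ cU) (hT : 1 ≤ T) (hV : 0 ≤ V) (hVT : V ≤ T) (hδ : 0 < δ) (hδ1 : δ ≤ 1)
    (hδT : c₁ ≤ T * δ) :
    ∫ ω, regret sel T δ (μ₁ · ω) (ρ · ω) (η · ω) ∂P ≤ 2 * δ * T + V +
      800 * (4 * 2 ^ β / cL + 1) * (1 + cU * (1 + Real.log c₁⁻¹)) * (1 + Real.log T) ^ 3 *
        ((V / δ + 1) * δ ^ (-b)) + (6 + 4 / c₁) := by
  have hT1 : (1 : ℝ) ≤ T := Nat.one_le_cast.2 hT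
  have hL := Real.log_natCast_nonneg T
  have hlogδ : 0 ≤ Real.log δ⁻¹ := Real.log_nonneg ((one_le_inv₀ hδ).2 hδ1)
  let M := ⌊2 * V / δ⌋₊ + 1
  let B := ⌈4 * Real.log T / (cL * (δ / 2) ^ β)⌉₊
  have hM : V < M * (δ / 2) := by
    have := Nat.lt_floor_add_one (2 * V / δ)
    rw [div_lt_iff₀ hδ] at this
    push_cast [M]
    linarith
  have hM' : (M : ℝ) ≤ 2 * V / δ + 1 := by
    push_cast [M]
    gcongr
    exact Nat.floor_le (by positivity)
  have hM2 : (M : ℝ) ≤ 2 * (V / δ + 1) := by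
    rw [mul_div_assoc] at hM'
    linarith
  have hB : 4 * Real.log T ≤ cL * (δ / 2) ^ β * B :=
    (div_le_iff₀' (by positivity)).1 (Nat.le_ceil _)
  have hB' : (B : ℝ) ≤ (4 * 2 ^ β / cL + 1) * (1 + Real.log T) * δ ^ (-β) :=
    natCeil_div_le_mul_rpow hβ hcL hδ hδ1 hL
  have hinv : 1 + cU * δ ^ (β - b) * Real.log δ⁻¹ ≤
      (1 + cU * (1 + Real.log c₁⁻¹)) * (1 + Real.log T) * δ ^ (β - b) :=
    one_add_mul_log_inv_le hcU hc₁ hc₁' hδ hT1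
      (Real.one_le_rpow_of_pos_of_le_one_of_nonpos hδ hδ1 (sub_nonpos.2 hβb)) hδT
  refine (h.integral_regret_le hsel hcU hV hδ hδ1 hT hb hβb hM (B := B)).trans ?_
  refine add_le_add (add_le_add le_rfl ?_) (failure_cost_le hT1 hV hVT hc₁ hδ hδT hM' hB)
  calc 400 * (1 + Real.log T) * (M * B * (1 + cU * δ ^ (β - b) * Real.log δ⁻¹))
      ≤ 400 * (1 + Real.log T) * (2 * (V / δ + 1) *
          ((4 * 2 ^ β / cL + 1) * (1 + Real.log T) * δ ^ (-β)) *
          ((1 + cU * (1 + Real.log c₁⁻¹)) * (1 + Real.log T) * δ ^ (β - b))) := by gcongr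
    _ = 800 * (4 * 2 ^ β / cL + 1) * (1 + cU * (1 + Real.log c₁⁻¹)) * (1 + Real.log T) ^ 3 *
          ((V / δ + 1) * (δ ^ (-β) * δ ^ (β - b))) := by ring
    _ = _ := by rw [← Real.rpow_add hδ, show -β + (β - b) = -b by ring]

/-- The constant of the regret bound for the threshold `c₁ * rate b V T`. -/
noncomputable def regretConst (β b c₁ cL cU : ℝ) : ℝ :=
  3 + 800 * (4 * 2 ^ β / cL + 1) * (1 + cU * (1 + Real.log c₁⁻¹)) *
    (c₁ ^ (-b - 1) + c₁ ^ (-b)) + (6 + 4 / c₁)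

lemma regretConst_pos (hc₁ : 0 < c₁) (hc₁' : c₁ ≤ 1) (hcL : 0 < cL) (hcU : 0 ≤ cU) :
    0 < regretConst β b c₁ cL cU := by
  have hlogc : 0 ≤ Real.log c₁⁻¹ := Real.log_nonneg ((one_le_inv₀ hc₁).2 hc₁')
  unfold regretConst
  positivity

lemma IsAnticipatingRotting.integral_regret_le_mul_rate
    (h : IsAnticipatingRotting P ℱ β cL cU T V μ₁ ρ η) (hsel : Function.Injective sel)
    (hβ : 0 ≤ β) (hb : 1 ≤ b) (hβb : β ≤ b) (hc₁ : 0 < c₁) (hc₁' : c₁ ≤ 1) (hcL : 0 < cL)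
    (hcU : 0 ≤ cU) (hT : 1 ≤ T) (hV : 0 ≤ V) (hVT : V ≤ T) :
    ∫ ω, regret sel T (c₁ * rate b V T) (μ₁ · ω) (ρ · ω) (η · ω) ∂P ≤
      regretConst β b c₁ cL cU * (1 + Real.log T) ^ 3 * (T * rate b V T) := by
  have hb0 : 0 ≤ b := by linarith
  have hg := rate_pos (b := b) (V := V) hT
  have hone := one_le_mul_rate hb0 hT hV hVT
  have hlogc : 0 ≤ Real.log c₁⁻¹ := Real.log_nonneg ((one_le_inv₀ hc₁).2 hc₁')
  have hL := Real.log_natCast_nonneg T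
  have hlog : 1 ≤ (1 + Real.log T) ^ 3 := one_le_pow₀ (le_add_of_nonneg_right hL)
  have hδT : c₁ ≤ T * (c₁ * rate b V T) := by
    rw [mul_left_comm]
    exact le_mul_of_one_le_right hc₁.le hone
  calc _ ≤ 2 * (c₁ * rate b V T) * T + V + 800 * (4 * 2 ^ β / cL + 1) *
          (1 + cU * (1 + Real.log c₁⁻¹)) * (1 + Real.log T) ^ 3 *
          ((V / (c₁ * rate b V T) + 1) * (c₁ * rate b V T) ^ (-b)) + (6 + 4 / c₁) :=
        h.integral_regret_le_rpow hsel hβ hb hβb hc₁ hc₁' hcL hcU hT hV hVT (by positivity)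
          (mul_le_one₀ hc₁' hg.le (rate_le_one hb0 hT hV hVT)) hδT
    _ ≤ 2 * (1 * rate b V T) * T + T * rate b V T + 800 * (4 * 2 ^ β / cL + 1) *
          (1 + cU * (1 + Real.log c₁⁻¹)) * (1 + Real.log T) ^ 3 *
          ((c₁ ^ (-b - 1) + c₁ ^ (-b)) * (T * rate b V T)) + (6 + 4 / c₁) * (T * rate b V T) := by
        refine add_le_add (add_le_add (add_le_add ?_ (budget_le_mul_rate hb0 hT hV hVT))
          (mul_le_mul_of_nonneg_left (budget_div_add_one_mul_rpow_le hb0 hT hV hc₁)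
            (by positivity))) (le_mul_of_one_le_right (by positivity) hone)
        gcongr
    _ = (3 + (6 + 4 / c₁)) * (T * rate b V T) * 1 + 800 * (4 * 2 ^ β / cL + 1) *
          (1 + cU * (1 + Real.log c₁⁻¹)) * (c₁ ^ (-b - 1) + c₁ ^ (-b)) *
          (T * rate b V T) * (1 + Real.log T) ^ 3 := by ring
    _ ≤ (3 + (6 + 4 / c₁)) * (T * rate b V T) * (1 + Real.log T) ^ 3 +
          800 * (4 * 2 ^ β / cL + 1) *
          (1 + cU * (1 + Real.log c₁⁻¹)) * (c₁ ^ (-b - 1) + c₁ ^ (-b)) *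
          (T * rate b V T) * (1 + Real.log T) ^ 3 := by gcongr
    _ = _ := by
        rw [regretConst]
        ring

end Parameters

end RottingBandit

theorem theorem1_general (β c₁ cL cU : ℝ) (hβ : 0 < β) (hc₁ : 0 < c₁) (hc₁' : c₁ ≤ 1)
    (hcL : 0 < cL) (hcU : 0 ≤ cU) :
    ∃ C : ℝ, 0 < C ∧ ∃ k : ℕ,
      ∀ (T : ℕ), 1 ≤ T → ∀ (V : ℝ), 0 ≤ V → V ≤ T →
      ∀ (A : Type*) (sel : ℕ → A), Function.Injective sel →
      ∀ (Ω : Type*) (mΩ : MeasurableSpace Ω) (P : Measure Ω) (_ : IsProbabilityMeasure P)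
        (ℱ : Filtration ℕ mΩ) (μ₁ : A → Ω → ℝ) (ρ η : ℕ → Ω → ℝ),
        RottingBandit.IsAnticipatingRotting P ℱ β cL cU T V μ₁ ρ η →
        Integrable (RottingBandit.regretV sel T c₁ β V μ₁ ρ η) P ∧
        (1 ≤ β → ∫ ω, RottingBandit.regretV sel T c₁ β V μ₁ ρ η ω ∂P ≤
          C * (1 + Real.log (T : ℝ)) ^ k *
          max (V ^ (1 / (β + 2)) * (T : ℝ) ^ ((β + 1) / (β + 2))) ((T : ℝ) ^ (β / (β + 1)))) ∧
        (β < 1 → ∫ ω, RottingBandit.regretV sel T c₁ β V μ₁ ρ η ω ∂P ≤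
          C * (1 + Real.log (T : ℝ)) ^ k *
          max (V ^ (1 / 3 : ℝ) * (T : ℝ) ^ (2 / 3 : ℝ)) (√(T : ℝ))) := by
  refine ⟨RottingBandit.regretConst β (max β 1) c₁ cL cU,
    RottingBandit.regretConst_pos hc₁ hc₁' hcL hcU, 3, ?_⟩
  intro T hT V hV hVT A sel hsel Ω mΩ P hP ℱ μ₁ ρ η h
  have hregret := h.integral_regret_le_mul_rate hsel hβ.le (le_max_right β 1) (le_max_left β 1)
    hc₁ hc₁' hcL hcU hT hV hVT
  rw [← RottingBandit.deltaV_eq_mul_rate, RottingBandit.mul_rate (by positivity) hT hV] at hregret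
  generalize RottingBandit.regretConst β (max β 1) c₁ cL cU = C at hregret ⊢
  refine ⟨h.integrable_regret hsel, fun hβ1 => ?_, fun hβ1 => ?_⟩
  · rwa [max_eq_left hβ1] at hregret
  · rw [max_eq_right hβ1.le] at hregret
    rw [Real.sqrt_eq_rpow]
    norm_num at hregret ⊢
    exact hregret

theorem theorem1 (β c₁ cL cU : ℝ) (hβ : 0 < β) (hc₁ : 0 < c₁) (hc₁' : c₁ < 1)
    (hcL : 0 < cL) (hcU : 0 < cU) :
    ∃ C : ℝ, 0 < C ∧ ∃ k : ℕ,
      ∀ (T : ℕ), 1 ≤ T → ∀ (V : ℝ), 0 ≤ V → V ≤ T →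
      ∀ (A : Type*) (sel : ℕ → A), Function.Injective sel →
      ∀ (Ω : Type*) (mΩ : MeasurableSpace Ω) (P : Measure Ω) (_ : IsProbabilityMeasure P)
        (ℱ : Filtration ℕ mΩ) (μ₁ : A → Ω → ℝ) (ρ η : ℕ → Ω → ℝ),
        RottingBandit.IsSlowRotting P ℱ β cL cU T V μ₁ ρ η →
        Integrable (RottingBandit.regretV sel T c₁ β V μ₁ ρ η) P ∧
        (1 ≤ β → ∫ ω, RottingBandit.regretV sel T c₁ β V μ₁ ρ η ω ∂P ≤
          C * (1 + Real.log (T : ℝ)) ^ k *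
          max (V ^ (1 / (β + 2)) * (T : ℝ) ^ ((β + 1) / (β + 2))) ((T : ℝ) ^ (β / (β + 1)))) ∧
        (β < 1 → ∫ ω, RottingBandit.regretV sel T c₁ β V μ₁ ρ η ω ∂P ≤
          C * (1 + Real.log (T : ℝ)) ^ k *
          max (V ^ (1 / 3 : ℝ) * (T : ℝ) ^ (2 / 3 : ℝ)) (√(T : ℝ))) := by
  obtain ⟨C, hC, k, h⟩ := theorem1_general β c₁ cL cU hβ hc₁ hc₁'.le hcL hcU.le
  exact ⟨C, hC, k, fun T hT V hV hVT A sel hsel Ω mΩ P hP ℱ μ₁ ρ η hR =>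
    h T hT V hV hVT A sel hsel Ω mΩ P hP ℱ μ₁ ρ η hR.isAnticipatingRotting⟩
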